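/- **Setting.** There are $n\ge 1$ candidates; candidate $i$ has a receiver value $\rho_i\ge 0$ and a sender value $\xi_i\ge 0$, where the $\rho_i$ are pairwise distinct and the $\xi_i$ are pairwise distinct. Sender and receiver both know all these pairs. The candidates arrive one per round in uniformly random order. In round $t$ the sender observes the arriving candidate $\theta_t$ and sends a signal $\sigma_t\in\{\mathrm{HIRE},\mathrm{NOT}\}$ according to a (possibly randomized) mechanism $\phi$, known to the receiver, that depends on $\theta_1,\dots,\theta_t$ and on internal randomness; the receiver then irrevocably hires $\theta_t$ (which ends the process) or rejects it. The receiver's decision in round $t$ is based on $\sigma_1,\dots,\sigma_t$ and, *with disclosure*, also on the rejected candidates $\theta_1,\dots,\theta_{t-1}$. The receiver maximizes the expected value $\rho$ of the hired candidate (0 if nobody is hired). A mechanism is *persuasive* if obedience (hiring exactly upon a HIRE signal) maximizes the receiver's expected utility among all her strategies. The sender has ordinal utility: the *success probability* of a mechanism is the probability that an obedient receiver hires the sender-optimal candidate, i.e. the one with maximum $\xi_i$. $\mathrm{OPT}$ denotes the supremum of the success probabilities of all mechanisms that are persuasive *without* disclosure. **Mechanism.** For a nonempty set $R$ of candidates with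 sender-optimal candidate $c$, put $\xi'_c=1$, $\xi'_i=0$ for $i\in R\setminus\{c\}$, let $\rho'$ be $\rho$ scaled to maximum $1$ on $R$ (left as it is if $\rho$ vanishes on $R$), and let $\mu=\frac1{|R|}\sum_{i\in R}\rho'_i$. The *Pareto procedure* on $R$ returns $c$ if $\rho'_c\ge\mu$. Otherwise it takes candidates $a,b\in R$ such that the segment between $(\rho'_a,\xi'_a)$ and $(\rho'_b,\xi'_b)$ lies on the Pareto frontier of the convex hull of $\{(\rho'_i,\xi'_i): i\in R\}$ and meets the line $\rho'=\mu$, and returns $a$ with probability $\frac{\mu-\rho'_b}{\rho'_a-\rho'_b}$ and $b$ otherwise. The *Shrinking Pareto mechanism* runs the Pareto procedure in every round $t$, with fresh randomness, on the set $R_t$ of candidates that have not been rejected so far (including $\theta_t$); it signals HIRE if the procedure returns $\theta_t$, and NOT otherwise; after its first HIRE signal it signals NOT forever. **Theorem.** 1. For every $n\ge1$ and every such instance with $n$ candidates, the Shrinking Pareto mechanism is persuasive with disclosure, and its success probability is at least $$\mathrm{OPT}\cdot\left(\frac12-\frac1{2n}\right).$$ 2. This is asymptotically optimal: for every $\varepsilon>0$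 there is an $N$ such that for every $n\ge N$ there is an instance with $n$ candidates in which every mechanism that is persuasive with disclosure has success probability at most $\left(\frac12+\varepsilon\right)\mathrm{OPT}$. -/

import Mathlib

open scoped BigOperators

namespace OnlinePersuasion

/-- The valuation pairs of the candidates: nonnegative, receiver values pairwise distinct, sender
values pairwise distinct. -/
structure IsInstance {n : ℕ} (ρ ξ : Fin n → ℝ) : Prop where
  rho_nonneg : ∀ i, 0 ≤ ρ i
  xi_nonneg : ∀ i, 0 ≤ ξ i
  rho_injective : Function.Injective ρ
  xi_injective : Function.Injective ξ

/-! ### Signaling mechanisms and receiver strategies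

A signal is a `Bool`, `true` meaning HIRE. All histories are lists with the newest entry first. -/

/-- A (randomized) direct signaling mechanism. In round `t` it signals HIRE with probability
`hireProb [θ_t, …, θ_1] [σ_{t-1}, …, σ_1]`, given the candidates `θ_1, …, θ_t` that arrived so far
and the signals `σ_1, …, σ_{t-1}` sent so far. Through the earlier signals the internal
randomization of different rounds may be correlated arbitrarily. -/
structure Mechanism (n : ℕ) where
  hireProb : List (Fin n) → List Bool → ℝ
  hireProb_nonneg : ∀ θ σ, 0 ≤ hireProb θ σ
  hireProb_le_one : ∀ θ σ, hireProb θ σ ≤ 1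

/-- The probability of sending the signal `s`. -/
def Mechanism.signalProb {n : ℕ} (φ : Mechanism n) (θ : List (Fin n)) (σ : List Bool)
    (s : Bool) : ℝ :=
  if s then φ.hireProb θ σ else 1 - φ.hireProb θ σ

/-- A strategy of the receiver with disclosure: from the rejected candidates
`[θ_{t-1}, …, θ_1]` and the signals `[σ_t, …, σ_1]` it decides whether to hire in round `t`. -/
abbrev Strategy (n : ℕ) : Type := List (Fin n) → List Bool → Bool

/-- Hire exactly when the current signal is HIRE. -/
def obedient {n : ℕ} : Strategy n
  | _, [] => false
  | _, s :: _ => s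

/-- The expectation, over the randomization of `φ`, of the value `v` of the hired candidate
(0 if nobody is hired), when the candidates in `past` have been rejected after the signals `σ` and
the candidates in the last argument arrive next, in this order. -/
def valueAlong {n : ℕ} (φ : Mechanism n) (r : Strategy n) (v : Fin n → ℝ) :
    List (Fin n) → List Bool → List (Fin n) → ℝ
  | _, _, [] => 0
  | past, σ, i :: rest =>
      ∑ s : Bool, φ.signalProb (i :: past) σ s *
        (if r past (s :: σ) then v i else valueAlong φ r v (i :: past) (s :: σ) rest)

/-- The expected value `v` of the hired candidate under uniformly random arrival order. -/
noncomputable def expectedValue {n : ℕ} (φ : Mechanism n) (r : Strategy n) (v : Fin n → ℝ) : ℝ :=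
  (∑ π : Equiv.Perm (Fin n), valueAlong φ r v [] [] (List.ofFn π)) / (Nat.factorial n : ℝ)

/-- Persuasiveness in the scenario with disclosure, for a receiver with cardinal utility `ρ`:
obedience maximizes the receiver's expected utility among all her strategies. As a strategy may
deviate from obedience at (and after) one single round and observed history only, this says that
obedience is optimal in every round, conditionally on every history that has positive probability
under obedience. -/
def PersuasiveWithDisclosure {n : ℕ} (ρ : Fin n → ℝ) (φ : Mechanism n) : Prop :=
  ∀ r : Strategy n, expectedValue φ r ρ ≤ expectedValue φ obedient ρ

/-- Persuasiveness in the scenario without disclosure: the receiver's decisions can depend on the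
signals only. -/
def PersuasiveWithoutDisclosure {n : ℕ} (ρ : Fin n → ℝ) (φ : Mechanism n) : Prop :=
  ∀ r : List Bool → Bool, expectedValue φ (fun _ σ => r σ) ρ ≤ expectedValue φ obedient ρ

/-! ### Ordinal sender utility and the benchmark -/

/-- `c` is a sender-optimal candidate of the set `R`. -/
def IsSenderBest {n : ℕ} (R : Finset (Fin n)) (ξ : Fin n → ℝ) (c : Fin n) : Prop :=
  c ∈ R ∧ ∀ j ∈ R, ξ j ≤ ξ c

open Classical in
/-- Ordinal sender utility on `R`: 1 for the sender-optimal candidate and 0 for all others. -/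
noncomputable def ordinalUtility {n : ℕ} (R : Finset (Fin n)) (ξ : Fin n → ℝ) (i : Fin n) : ℝ :=
  if IsSenderBest R ξ i then 1 else 0

/-- The probability that the sender-optimal candidate is hired by an obedient receiver. -/
noncomputable def successProb {n : ℕ} (ξ : Fin n → ℝ) (φ : Mechanism n) : ℝ :=
  expectedValue φ obedient (ordinalUtility Finset.univ ξ)

/-- The benchmark: the optimal success probability of persuasive mechanisms in the basic scenario
without disclosure. -/
noncomputable def OPT {n : ℕ} (ρ ξ : Fin n → ℝ) : ℝ :=
  sSup {p : ℝ | ∃ φ : Mechanism n, PersuasiveWithoutDisclosure ρ φ ∧ p = successProb ξ φ}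

/-! ### The Pareto procedure -/

/-- The average receiver value of the candidates in `R`. -/
noncomputable def mean {n : ℕ} (R : Finset (Fin n)) (ρ : Fin n → ℝ) : ℝ :=
  (∑ i ∈ R, ρ i) / (R.card : ℝ)

/-- The Pareto frontier of the convex hull of the valuation pairs `(ρ i, ξ i)`, `i ∈ R`. -/
def paretoCurve {n : ℕ} (R : Finset (Fin n)) (ρ ξ : Fin n → ℝ) : Set (ℝ × ℝ) :=
  {p | Maximal (· ∈ convexHull ℝ ((fun i => (ρ i, ξ i)) '' (R : Set (Fin n)))) p}

/-- The pairs `(a, b)` that the Pareto procedure can select on input `R`: if the sender-optimal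
candidate has at least average receiver value, `a = b` is this candidate; otherwise the segment from
`a` to `b` is part of the Pareto frontier and meets the vertical line at the average receiver
value. -/
def IsParetoPair {n : ℕ} (R : Finset (Fin n)) (ρ ξ : Fin n → ℝ) (a b : Fin n) : Prop :=
  (IsSenderBest R ξ a ∧ mean R ρ ≤ ρ a ∧ b = a) ∨
  ((∀ c, IsSenderBest R ξ c → ρ c < mean R ρ) ∧ a ∈ R ∧ b ∈ R ∧
    segment ℝ (ρ a, ξ a) (ρ b, ξ b) ⊆ paretoCurve R ρ ξ ∧
    ∃ p ∈ segment ℝ (ρ a, ξ a) (ρ b, ξ b), p.1 = mean R ρ)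

open Classical in
/-- The threshold `α` computed by the Pareto procedure. -/
noncomputable def paretoAlpha {n : ℕ} (R : Finset (Fin n)) (ρ ξ : Fin n → ℝ) (a b : Fin n) : ℝ :=
  if ρ a = ρ b then 1 else if ξ a = ξ b then 0 else (mean R ρ - ρ b) / (ρ a - ρ b)

open Classical in
/-- The distribution of the candidate returned by the Pareto procedure on `R`: `a` if a uniform
number from `[0, 1]` is at most `α` (which has probability `max 0 (min 1 α)`), and `b` otherwise. -/
noncomputable def paretoLottery {n : ℕ} (R : Finset (Fin n)) (ρ ξ : Fin n → ℝ) (i : Fin n) : ℝ :=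
  if h : ∃ p : Fin n × Fin n, IsParetoPair R ρ ξ p.1 p.2 then
    let a := h.choose.1
    let b := h.choose.2
    let q := max 0 (min 1 (paretoAlpha R ρ ξ a b))
    (if i = a then q else 0) + (if i = b then 1 - q else 0)
  else 0

/-- The Pareto procedure for ordinal sender utility: receiver values are scaled to maximum 1 on `R`,
sender values are replaced by 1 for the sender-optimal candidate of `R` and 0 for the others. -/
noncomputable def ordinalParetoLottery {n : ℕ} (ρ ξ : Fin n → ℝ) (R : Finset (Fin n)) :
    Fin n → ℝ :=
  paretoLottery R (fun i => ρ i / sSup (ρ '' (R : Set (Fin n)))) (ordinalUtility R ξ)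

theorem paretoLottery_mem {n : ℕ} (R : Finset (Fin n)) (ρ ξ : Fin n → ℝ) (i : Fin n) :
    0 ≤ paretoLottery R ρ ξ i ∧ paretoLottery R ρ ξ i ≤ 1 := by
  have key : ∀ (a b : Fin n) (q : ℝ), 0 ≤ q → q ≤ 1 →
      0 ≤ (if i = a then q else 0) + (if i = b then 1 - q else 0) ∧
        (if i = a then q else 0) + (if i = b then 1 - q else 0) ≤ 1 := by
    intro a b q h0 h1
    split_ifs <;> constructor <;> linarith
  unfold paretoLottery
  split_ifs with h
  · exact key _ _ _ (le_max_left _ _) (max_le zero_le_one (min_le_left _ _))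
  · exact ⟨le_rfl, zero_le_one⟩

/-! ### The Shrinking Pareto mechanism -/

/-- With `i` arriving after the candidates in `past`, the set of remaining candidates (including
`i`) is the complement of `past`. The mechanism runs the Pareto procedure on this set, with fresh
randomness, and signals HIRE iff the procedure returns `i`. Once it has signaled HIRE it never does
so again. -/
noncomputable def shrinkingParetoHireProb {n : ℕ} (ρ ξ : Fin n → ℝ) :
    List (Fin n) → List Bool → ℝ
  | [], _ => 0
  | i :: past, σ =>
      if true ∈ σ then 0 else ordinalParetoLottery ρ ξ (Finset.univ \ past.toFinset) i

/-- The Shrinking Pareto mechanism for ordinal sender utility. -/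
noncomputable def shrinkingPareto {n : ℕ} (ρ ξ : Fin n → ℝ) : Mechanism n where
  hireProb := shrinkingParetoHireProb ρ ξ
  hireProb_nonneg := by
    intro θ σ
    cases θ with
    | nil => exact le_rfl
    | cons i past =>
      simp only [shrinkingParetoHireProb]
      split_ifs
      · exact le_rfl
      · exact (paretoLottery_mem _ _ _ _).1
  hireProb_le_one := by
    intro θ σ
    cases θ with
    | nil => exact zero_le_one
    | cons i past =>
      simp only [shrinkingParetoHireProb]
      split_ifs
      · exact zero_le_one
      · exact (paretoLottery_mem _ _ _ _).2

end OnlinePersuasion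

open scoped BigOperators

namespace OnlinePersuasion

/-! ### Averaging over arrival orders -/

/-! With ordinal sender utility the Pareto procedure is explicit: it mixes only the sender-optimal
candidate `c` and the receiver-optimal candidate `M` of the remaining set. It returns `c` with the
largest probability that keeps the expected receiver value at or above the average
(`ordinalParetoLottery_eq`, `senderProb`).

Persuasiveness: after a HIRE signal the later signals carry no information, so refusing it yields at
most the average of the others. Obedience after NOT signals only always secures at least the average
of the remaining candidates. Since the lottery's value is at least the average, every one-round
deviation loses, and induction on the number of remaining candidates gives
`shrinkingPareto_remainingValue_le`.

Success probability: OPT is at most the lottery probability of `c` on all candidates, because a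
signal-only receiver can hire the first arrival and get the average
(`successProb_le_ordinalParetoLottery`). An induction then shows that from any set of `k` candidates
with `c` still available the mechanism succeeds with at least `1/2 - 1/(2k)` times the current
lottery probability of `c`. The induction step rests on `ordinalParetoLottery_mul_le_sum_erase`: on
average, deleting a random candidate does not lower the probability of `c` too much.

Tightness: let `c` have receiver value 0, one candidate `M` value 1, and all others value close to
`1 - h`. Without disclosure, drawing `c` with probability about `h` and `M` otherwise is persuasive,
so OPT is about `h` or more (`le_OPT`). With disclosure, consider the receiver who, while `c` has
not been rejected, skips the HIRE signal and hires the next arrival. She gains about `1 - h`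
whenever `c` was recommended, and loses about `h` only when `M` is recommended before `c` arrives.
As `M` precedes `c` with probability 1/2, persuasiveness forces a success probability of at most
about `h/2` (`mul_successProb_le`). -/

/-- All arrival orders of the candidates in `R`, a set of `k` candidates. -/
def orders {α : Type*} [DecidableEq α] : ℕ → Finset α → Finset (List α)
  | 0, _ => {[]}
  | k + 1, R => R.biUnion fun i => (orders k (R.erase i)).image (List.cons i)

/-- The average of `f` over all arrival orders of the candidates in `R`, a set of `k` candidates. -/
noncomputable def avgOrders {α : Type*} [DecidableEq α] :
    ℕ → Finset α → (List α → ℝ) → ℝ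
  | 0, _, f => f []
  | k + 1, R, f => (∑ i ∈ R, avgOrders k (R.erase i) fun l => f (i :: l)) / ((k : ℝ) + 1)

theorem mem_orders {α : Type*} [DecidableEq α] (k : ℕ) (R : Finset α) (hR : R.card = k)
    (l : List α) : l ∈ orders k R ↔ l.Nodup ∧ l.toFinset = R := by
  induction k generalizing R l with
  | zero =>
    rw [Finset.card_eq_zero] at hR
    subst hR
    simp only [orders, Finset.mem_singleton, List.toFinset_eq_empty_iff]
    constructor
    · rintro rfl
      simp
    · exact fun h => h.2
  | succ k ih =>
    simp only [orders, Finset.mem_biUnion, Finset.mem_image]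
    constructor
    · rintro ⟨i, hi, l', hl', rfl⟩
      rw [ih (R.erase i) (by rw [Finset.card_erase_of_mem hi, hR]; rfl)] at hl'
      refine ⟨List.nodup_cons.2 ⟨?_, hl'.1⟩, ?_⟩
      · rw [← List.mem_toFinset, hl'.2]
        simp
      · rw [List.toFinset_cons, hl'.2, Finset.insert_erase hi]
    · rintro ⟨h1, h2⟩
      cases l with
      | nil =>
        rw [List.toFinset_nil] at h2
        rw [← h2] at hR
        simp at hR
      | cons i l' =>
        have hi : i ∈ R := by rw [← h2]; simp
        rw [List.nodup_cons] at h1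
        refine ⟨i, hi, l', ?_, rfl⟩
        rw [ih (R.erase i) (by rw [Finset.card_erase_of_mem hi, hR]; rfl)]
        refine ⟨h1.2, ?_⟩
        rw [← h2, List.toFinset_cons, Finset.erase_insert]
        simpa using h1.1

theorem sum_orders {α : Type*} [DecidableEq α] (k : ℕ) (R : Finset α) (hR : R.card = k)
    (f : List α → ℝ) :
    ∑ l ∈ orders k R, f l = (k.factorial : ℝ) * avgOrders k R f := by
  induction k generalizing R f with
  | zero => simp [orders, avgOrders]
  | succ k ih =>
    rw [orders, Finset.sum_biUnion]
    · have : ∀ i ∈ R, ∑ l ∈ (orders k (R.erase i)).image (List.cons i), f l =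
          (k.factorial : ℝ) * avgOrders k (R.erase i) fun l => f (i :: l) := by
        intro i hi
        rw [Finset.sum_image (fun a _ b _ h => (List.cons.inj h).2),
          ih (R.erase i) (by rw [Finset.card_erase_of_mem hi, hR]; rfl)]
      rw [Finset.sum_congr rfl this, ← Finset.mul_sum, avgOrders, Nat.factorial_succ]
      push_cast
      have : (k : ℝ) + 1 ≠ 0 := by positivity
      field_simp
    · intro i _ j _ hij
      rw [Function.onFun, Finset.disjoint_left]
      intro l h1 h2
      rw [Finset.mem_image] at h1 h2
      obtain ⟨a, _, rfl⟩ := h1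
      obtain ⟨b, _, hb⟩ := h2
      exact hij (List.cons.inj hb).1.symm

theorem sum_perm_ofFn {n : ℕ} (f : List (Fin n) → ℝ) :
    ∑ π : Equiv.Perm (Fin n), f (List.ofFn π) = ∑ l ∈ orders n Finset.univ, f l := by
  have hn : (Finset.univ : Finset (Fin n)).card = n := by simp
  refine Finset.sum_bij (fun π _ => List.ofFn π) ?_ ?_ ?_ (fun _ _ => rfl)
  · intro π _
    rw [mem_orders n _ hn]
    refine ⟨List.nodup_ofFn.2 π.injective, ?_⟩
    ext i
    simp only [List.mem_toFinset, List.mem_ofFn, Finset.mem_univ, iff_true]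
    exact π.surjective i
  · intro π _ π' _ h
    exact DFunLike.coe_injective (List.ofFn_injective h)
  · intro l hl
    rw [mem_orders n _ hn] at hl
    have hlen : l.length = n := by
      rw [← List.toFinset_card_of_nodup hl.1, hl.2, hn]
    have hinj : Function.Injective (fun i : Fin n => l.get (i.cast hlen.symm)) := by
      intro a b h
      have := (List.nodup_iff_injective_get.1 hl.1) h
      simpa [Fin.ext_iff] using this
    refine ⟨Equiv.ofBijective _ (Finite.injective_iff_bijective.1 hinj), Finset.mem_univ _, ?_⟩
    apply List.ext_get
    · simp [hlen]
    · intro i h1 h2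
      simp

/-- Replaces permutations by a recursion on the first arrival, so that later arguments can induct on
the number of remaining candidates. -/
theorem expectedValue_eq_avgOrders {n : ℕ} (φ : Mechanism n) (r : Strategy n) (v : Fin n → ℝ) :
    expectedValue φ r v = avgOrders n Finset.univ (valueAlong φ r v [] []) := by
  rw [expectedValue, sum_perm_ofFn (valueAlong φ r v [] []), sum_orders n _ (by simp)]
  have : (n.factorial : ℝ) ≠ 0 := by positivity
  field_simp

theorem avgOrders_add {α : Type*} [DecidableEq α] (k : ℕ) (R : Finset α) (f g : List α → ℝ) :
    avgOrders k R (fun l => f l + g l) = avgOrders k R f + avgOrders k R g := by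
  induction k generalizing R f g with
  | zero => rfl
  | succ k ih => simp only [avgOrders, ih, Finset.sum_add_distrib, add_div]

theorem avgOrders_const_mul {α : Type*} [DecidableEq α] (k : ℕ) (R : Finset α) (a : ℝ)
    (f : List α → ℝ) : avgOrders k R (fun l => a * f l) = a * avgOrders k R f := by
  induction k generalizing R f with
  | zero => rfl
  | succ k ih => simp only [avgOrders, ih, ← Finset.mul_sum, mul_div_assoc]

theorem avgOrders_mono {α : Type*} [DecidableEq α] (k : ℕ) (R : Finset α) (f g : List α → ℝ)
    (h : ∀ l, f l ≤ g l) : avgOrders k R f ≤ avgOrders k R g := by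
  induction k generalizing R f g with
  | zero => exact h []
  | succ k ih =>
    simp only [avgOrders]
    gcongr with i _
    exact ih _ _ _ fun l => h _

theorem avgOrders_congr {α : Type*} [DecidableEq α] (k : ℕ) (R : Finset α) (hR : R.card = k)
    (f g : List α → ℝ) (h : ∀ l : List α, l.Nodup → l.toFinset = R → f l = g l) :
    avgOrders k R f = avgOrders k R g := by
  have h1 := sum_orders k R hR f
  rw [Finset.sum_congr rfl fun l hl => h l ((mem_orders k R hR l).1 hl).1
    ((mem_orders k R hR l).1 hl).2, sum_orders k R hR g] at h1
  exact (mul_left_cancel₀ (by positivity) h1).symm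

theorem card_erase_of_card_succ {α : Type*} [DecidableEq α] {k : ℕ} {R : Finset α} {i : α}
    (hR : R.card = k + 1) (hi : i ∈ R) : (R.erase i).card = k := by
  rw [Finset.card_erase_of_mem hi, hR]; rfl

theorem avgOrders_const {α : Type*} [DecidableEq α] (k : ℕ) (R : Finset α) (hR : R.card = k)
    (a : ℝ) : avgOrders k R (fun _ => a) = a := by
  induction k generalizing R with
  | zero => rfl
  | succ k ih =>
    rw [avgOrders, Finset.sum_congr rfl fun i hi => ih _ (card_erase_of_card_succ hR hi),
      Finset.sum_const, hR, nsmul_eq_mul]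
    push_cast
    have : (k : ℝ) + 1 ≠ 0 := by positivity
    field_simp

/-- The expected value of the hired candidate when the candidates in `past` have been rejected after
the signals `σ` and the `k` candidates in `R` arrive next in random order. -/
noncomputable def remainingValue {n : ℕ} (φ : Mechanism n) (r : Strategy n) (v : Fin n → ℝ)
    (past : List (Fin n)) (σ : List Bool) (k : ℕ) (R : Finset (Fin n)) : ℝ :=
  avgOrders k R (valueAlong φ r v past σ)

theorem remainingValue_zero {n : ℕ} (φ : Mechanism n) (r : Strategy n) (v : Fin n → ℝ)
    (past : List (Fin n)) (σ : List Bool) (R : Finset (Fin n)) :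
    remainingValue φ r v past σ 0 R = 0 := rfl

theorem remainingValue_succ {n : ℕ} (φ : Mechanism n) (r : Strategy n) (v : Fin n → ℝ)
    (past : List (Fin n)) (σ : List Bool) (k : ℕ) (R : Finset (Fin n)) (hR : R.card = k + 1) :
    remainingValue φ r v past σ (k + 1) R =
      (∑ i ∈ R, (φ.hireProb (i :: past) σ *
          (if r past (true :: σ) then v i
            else remainingValue φ r v (i :: past) (true :: σ) k (R.erase i)) +
        (1 - φ.hireProb (i :: past) σ) *
          (if r past (false :: σ) then v i
            else remainingValue φ r v (i :: past) (false :: σ) k (R.erase i)))) /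
        ((k : ℝ) + 1) := by
  rw [remainingValue, avgOrders]
  congr 1
  refine Finset.sum_congr rfl fun i hi => ?_
  have hc := card_erase_of_card_succ hR hi
  simp only [valueAlong, Fintype.sum_bool, Mechanism.signalProb, if_true, Bool.false_eq_true,
    if_false]
  rw [avgOrders_add, avgOrders_const_mul, avgOrders_const_mul]
  congr 2 <;> split_ifs
  · exact avgOrders_const k _ hc _
  · rfl
  · exact avgOrders_const k _ hc _
  · rfl

theorem expectedValue_eq_remainingValue {n : ℕ} (φ : Mechanism n) (r : Strategy n)
    (v : Fin n → ℝ) : expectedValue φ r v = remainingValue φ r v [] [] n Finset.univ :=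
  expectedValue_eq_avgOrders φ r v

theorem obedient_cons {n : ℕ} (past : List (Fin n)) (s : Bool) (σ : List Bool) :
    obedient past (s :: σ) = s := rfl

theorem remainingValue_obedient_succ {n : ℕ} (φ : Mechanism n) (v : Fin n → ℝ)
    (past : List (Fin n)) (σ : List Bool) (k : ℕ) (R : Finset (Fin n)) (hR : R.card = k + 1) :
    remainingValue φ obedient v past σ (k + 1) R =
      (∑ i ∈ R, (φ.hireProb (i :: past) σ * v i + (1 - φ.hireProb (i :: past) σ) *
          remainingValue φ obedient v (i :: past) (false :: σ) k (R.erase i))) /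
        ((k : ℝ) + 1) := by
  rw [remainingValue_succ φ obedient v past σ k R hR]
  simp [obedient_cons]

/-! ### Linearity and monotonicity in the value of the candidates -/

theorem signalProb_nonneg {n : ℕ} (φ : Mechanism n) (θ : List (Fin n)) (σ : List Bool) (s : Bool) :
    0 ≤ φ.signalProb θ σ s := by
  unfold Mechanism.signalProb
  split_ifs
  · exact φ.hireProb_nonneg θ σ
  · linarith [φ.hireProb_le_one θ σ]

theorem valueAlong_mono {n : ℕ} (φ : Mechanism n) (r : Strategy n) (v w : Fin n → ℝ)
    (h : ∀ i, v i ≤ w i) (l : List (Fin n)) (past : List (Fin n)) (σ : List Bool) :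
    valueAlong φ r v past σ l ≤ valueAlong φ r w past σ l := by
  induction l generalizing past σ with
  | nil => exact le_rfl
  | cons i rest ih =>
    simp only [valueAlong]
    refine Finset.sum_le_sum fun s _ => mul_le_mul_of_nonneg_left ?_ (signalProb_nonneg _ _ _ _)
    split_ifs
    · exact h i
    · exact ih _ _

theorem valueAlong_linear {n : ℕ} (φ : Mechanism n) (r : Strategy n) (v w : Fin n → ℝ) (a : ℝ)
    (l : List (Fin n)) (past : List (Fin n)) (σ : List Bool) :
    valueAlong φ r (fun i => v i + a * w i) past σ l =
      valueAlong φ r v past σ l + a * valueAlong φ r w past σ l := by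
  induction l generalizing past σ with
  | nil => simp [valueAlong]
  | cons i rest ih =>
    simp only [valueAlong, ih]
    rw [Finset.mul_sum, ← Finset.sum_add_distrib]
    refine Finset.sum_congr rfl fun s _ => ?_
    split_ifs <;> ring

theorem valueAlong_const_le {n : ℕ} (φ : Mechanism n) (r : Strategy n) (a : ℝ) (ha : 0 ≤ a)
    (l : List (Fin n)) (past : List (Fin n)) (σ : List Bool) :
    valueAlong φ r (fun _ => a) past σ l ≤ a := by
  induction l generalizing past σ with
  | nil => exact ha
  | cons i rest ih =>
    have h : ∀ s, (if r past (s :: σ) then a else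
        valueAlong φ r (fun _ => a) (i :: past) (s :: σ) rest) ≤ a := by
      intro s
      split_ifs
      · exact le_rfl
      · exact ih _ _
    calc valueAlong φ r (fun _ => a) past σ (i :: rest)
        ≤ ∑ s : Bool, φ.signalProb (i :: past) σ s * a := by
          simp only [valueAlong]
          exact Finset.sum_le_sum fun s _ =>
            mul_le_mul_of_nonneg_left (h s) (signalProb_nonneg _ _ _ _)
      _ = a := by
          simp only [Fintype.sum_bool, Mechanism.signalProb]
          simp only [if_true, Bool.false_eq_true, if_false]
          ring

theorem valueAlong_zero {n : ℕ} (φ : Mechanism n) (r : Strategy n)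
    (l : List (Fin n)) (past : List (Fin n)) (σ : List Bool) :
    valueAlong φ r (fun _ => 0) past σ l = 0 := by
  have := valueAlong_linear φ r (fun _ => 0) (fun _ => 0) (-1) l past σ
  simp only [mul_zero, add_zero] at this
  linarith

theorem valueAlong_nonneg {n : ℕ} (φ : Mechanism n) (r : Strategy n) (v : Fin n → ℝ)
    (h : ∀ i, 0 ≤ v i) (l : List (Fin n)) (past : List (Fin n)) (σ : List Bool) :
    0 ≤ valueAlong φ r v past σ l := by
  rw [← valueAlong_zero φ r l past σ]
  exact valueAlong_mono φ r _ _ h l past σ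

theorem remainingValue_nonneg {n : ℕ} (φ : Mechanism n) (r : Strategy n) (v : Fin n → ℝ)
    (h : ∀ i, 0 ≤ v i) (past : List (Fin n)) (σ : List Bool) (k : ℕ) (R : Finset (Fin n))
    (hR : R.card = k) : 0 ≤ remainingValue φ r v past σ k R := by
  rw [remainingValue, ← avgOrders_const k R hR 0]
  exact avgOrders_mono k R _ _ fun l => valueAlong_nonneg φ r v h l past σ

theorem expectedValue_mono {n : ℕ} (φ : Mechanism n) (r : Strategy n) (v w : Fin n → ℝ)
    (h : ∀ i, v i ≤ w i) : expectedValue φ r v ≤ expectedValue φ r w := by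
  rw [expectedValue_eq_avgOrders, expectedValue_eq_avgOrders]
  exact avgOrders_mono _ _ _ _ fun l => valueAlong_mono φ r v w h l [] []

theorem expectedValue_linear {n : ℕ} (φ : Mechanism n) (r : Strategy n) (v w : Fin n → ℝ) (a : ℝ) :
    expectedValue φ r (fun i => v i + a * w i) =
      expectedValue φ r v + a * expectedValue φ r w := by
  simp only [expectedValue_eq_avgOrders]
  rw [← avgOrders_const_mul, ← avgOrders_add]
  congr 1
  ext l
  exact valueAlong_linear φ r v w a l [] []

theorem expectedValue_const_le {n : ℕ} (φ : Mechanism n) (r : Strategy n) (a : ℝ) (ha : 0 ≤ a) :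
    expectedValue φ r (fun _ => a) ≤ a := by
  rw [expectedValue_eq_avgOrders]
  calc _ ≤ avgOrders n Finset.univ (fun _ : List (Fin n) => a) :=
        avgOrders_mono _ _ _ _ fun l => valueAlong_const_le φ r a ha l [] []
    _ = a := avgOrders_const n _ (by simp) a

theorem expectedValue_nonneg {n : ℕ} (φ : Mechanism n) (r : Strategy n) (v : Fin n → ℝ)
    (h : ∀ i, 0 ≤ v i) : 0 ≤ expectedValue φ r v := by
  rw [expectedValue_eq_remainingValue]
  exact remainingValue_nonneg φ r v h [] [] n _ (by simp)

/-! ### Ordinal utility as the indicator of the unique sender-optimal candidate. -/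

theorem ordinalUtility_nonneg {n : ℕ} (R : Finset (Fin n)) (ξ : Fin n → ℝ) (i : Fin n) :
    0 ≤ ordinalUtility R ξ i := by
  unfold ordinalUtility
  split_ifs <;> norm_num

theorem ordinalUtility_le_one {n : ℕ} (R : Finset (Fin n)) (ξ : Fin n → ℝ) (i : Fin n) :
    ordinalUtility R ξ i ≤ 1 := by
  unfold ordinalUtility
  split_ifs <;> norm_num

theorem isSenderBest_unique {n : ℕ} {R : Finset (Fin n)} {ξ : Fin n → ℝ}
    (hξ : Function.Injective ξ) {c d : Fin n} (hc : IsSenderBest R ξ c) (hd : IsSenderBest R ξ d) :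
    c = d :=
  hξ (le_antisymm (hd.2 c hc.1) (hc.2 d hd.1))

theorem ordinalUtility_eq {n : ℕ} {R : Finset (Fin n)} {ξ : Fin n → ℝ}
    (hξ : Function.Injective ξ) {c : Fin n} (hc : IsSenderBest R ξ c) (i : Fin n) :
    ordinalUtility R ξ i = if i = c then 1 else 0 := by
  unfold ordinalUtility
  by_cases h : i = c
  · subst h
    simp [hc]
  · rw [if_neg h, if_neg fun h' => h (isSenderBest_unique hξ h' hc)]

theorem successProb_le_one {n : ℕ} (ξ : Fin n → ℝ) (φ : Mechanism n) : successProb ξ φ ≤ 1 :=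
  (expectedValue_mono φ _ _ _ (ordinalUtility_le_one _ _)).trans
    (expectedValue_const_le φ _ 1 zero_le_one)

/-! ### The lottery of the Pareto procedure for ordinal sender utility -/

theorem isSenderBest_indicator {n : ℕ} {R : Finset (Fin n)} {u : Fin n → ℝ} {c : Fin n}
    (hc : c ∈ R) (hu : ∀ i, u i = if i = c then 1 else 0) (a : Fin n) :
    IsSenderBest R u a ↔ a = c := by
  constructor
  · intro h
    by_contra hne
    have := h.2 c hc
    rw [hu, hu, if_pos rfl, if_neg hne] at this
    linarith
  · rintro rfl
    refine ⟨hc, fun j _ => ?_⟩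
    rw [hu, hu, if_pos rfl]
    split_ifs <;> norm_num

theorem mean_lt_of_lt {n : ℕ} {R : Finset (Fin n)} {ρ : Fin n → ℝ} {c M : Fin n} (hc : c ∈ R)
    (hM : ∀ j ∈ R, ρ j ≤ ρ M) (h : ρ c < ρ M) : mean R ρ < ρ M := by
  have hpos : (0 : ℝ) < R.card := by exact_mod_cast Finset.card_pos.2 ⟨c, hc⟩
  rw [mean, div_lt_iff₀ hpos]
  calc ∑ i ∈ R, ρ i < ∑ i ∈ R, ρ M := Finset.sum_lt_sum hM ⟨c, hc, h⟩
    _ = ρ M * R.card := by rw [Finset.sum_const, nsmul_eq_mul, mul_comm]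

theorem mean_le_of_le {n : ℕ} {R : Finset (Fin n)} {ρ : Fin n → ℝ} {M : Fin n} (hMR : M ∈ R)
    (hM : ∀ j ∈ R, ρ j ≤ ρ M) : mean R ρ ≤ ρ M := by
  have hpos : (0 : ℝ) < R.card := by exact_mod_cast Finset.card_pos.2 ⟨M, hMR⟩
  rw [mean, div_le_iff₀ hpos]
  calc ∑ i ∈ R, ρ i ≤ ∑ i ∈ R, ρ M := Finset.sum_le_sum hM
    _ = ρ M * R.card := by rw [Finset.sum_const, nsmul_eq_mul, mul_comm]

theorem paretoLottery_of_mean_le {n : ℕ} {R : Finset (Fin n)} {ρ u : Fin n → ℝ} {c : Fin n}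
    (hc : c ∈ R) (hu : ∀ i, u i = if i = c then 1 else 0) (h : mean R ρ ≤ ρ c) (i : Fin n) :
    paretoLottery R ρ u i = if i = c then 1 else 0 := by
  have hex : ∃ p : Fin n × Fin n, IsParetoPair R ρ u p.1 p.2 :=
    ⟨(c, c), Or.inl ⟨(isSenderBest_indicator hc hu c).2 rfl, h, rfl⟩⟩
  have key : ∀ p : Fin n × Fin n, IsParetoPair R ρ u p.1 p.2 → p.1 = c ∧ p.2 = c := by
    rintro ⟨a, b⟩ (⟨h1, _, h3⟩ | ⟨h1, _⟩)
    · have := (isSenderBest_indicator hc hu a).1 h1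
      exact ⟨this, h3.trans this⟩
    · exact absurd (h1 c ((isSenderBest_indicator hc hu c).2 rfl)) (not_lt.2 h)
  obtain ⟨h1, h2⟩ := key _ hex.choose_spec
  rw [paretoLottery, dif_pos hex]
  simp only [h1, h2, paretoAlpha, if_true]
  split_ifs <;> norm_num

/-- The segment between the sender-optimal and the receiver-optimal candidate is part of the
Pareto frontier. -/
theorem segment_subset_paretoCurve {n : ℕ} {R : Finset (Fin n)} {ρ u : Fin n → ℝ} {c M : Fin n}
    (hc : c ∈ R) (hu : ∀ i, u i = if i = c then 1 else 0) (hMR : M ∈ R)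
    (hM : ∀ j ∈ R, ρ j ≤ ρ M) (hlt : ρ c < ρ M) :
    segment ℝ (ρ c, u c) (ρ M, u M) ⊆ paretoCurve R ρ u := by
  have hMc : M ≠ c := by rintro rfl; exact lt_irrefl _ hlt
  have huc : u c = 1 := by rw [hu, if_pos rfl]
  have huM : u M = 0 := by rw [hu, if_neg hMc]
  -- The line through the two points supports the hull, and both of its coefficients are positive;
  -- so a hull point dominating a point of the line equals it.
  have hhull : convexHull ℝ ((fun i => (ρ i, u i)) '' (R : Set (Fin n))) ⊆
      {y : ℝ × ℝ | y.1 + (ρ M - ρ c) * y.2 ≤ ρ M} := by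
    refine convexHull_min ?_ ?_
    · rintro _ ⟨i, hi, rfl⟩
      simp only [Set.mem_ofPred_eq, hu]
      split_ifs with h
      · rw [h]; linarith
      · linarith [hM i hi]
    · intro x hx y hy s t hs ht hst
      simp only [Set.mem_ofPred_eq, Prod.fst_add, Prod.snd_add, Prod.smul_fst, Prod.smul_snd,
        smul_eq_mul] at *
      have h1 := mul_le_mul_of_nonneg_left hx hs
      have h2 := mul_le_mul_of_nonneg_left hy ht
      have : s * ρ M + t * ρ M = ρ M := by rw [← add_mul, hst, one_mul]
      linarith
  intro p hp
  have hpL : p.1 + (ρ M - ρ c) * p.2 = ρ M := by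
    obtain ⟨s, t, _, _, hst, rfl⟩ := hp
    simp only [Prod.fst_add, Prod.snd_add, Prod.smul_fst, Prod.smul_snd, smul_eq_mul, huc, huM]
    obtain rfl : s = 1 - t := by linarith
    ring
  refine ⟨segment_subset_convexHull (Set.mem_image_of_mem _ hc) (Set.mem_image_of_mem _ hMR) hp,
    fun y hy hpy => ?_⟩
  have hy' := hhull hy
  simp only [Set.mem_ofPred_eq] at hy'
  have hd : 0 < ρ M - ρ c := by linarith
  have h2 := mul_le_mul_of_nonneg_left hpy.2 hd.le
  refine ⟨by linarith [hpy.1], ?_⟩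
  have : (ρ M - ρ c) * y.2 ≤ (ρ M - ρ c) * p.2 := by linarith [hpy.1]
  exact le_of_mul_le_mul_left this hd

/-- The chosen Pareto pair can only be `(c, M)` or `(M, c)`, and both orders induce the same
distribution, so the arbitrary choice in the definition is harmless. -/
theorem paretoLottery_of_lt_mean {n : ℕ} {R : Finset (Fin n)} {ρ u : Fin n → ℝ} {c M : Fin n}
    (hc : c ∈ R) (hu : ∀ i, u i = if i = c then 1 else 0) (hMR : M ∈ R)
    (hM : ∀ j ∈ R, ρ j ≤ ρ M) (hρ : Function.Injective ρ) (h : ρ c < mean R ρ) (i : Fin n) :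
    paretoLottery R ρ u i = if i = c then (ρ M - mean R ρ) / (ρ M - ρ c) else
      if i = M then 1 - (ρ M - mean R ρ) / (ρ M - ρ c) else 0 := by
  have hlt : ρ c < ρ M := h.trans_le (mean_le_of_le hMR hM)
  have hmean := mean_lt_of_lt hc hM hlt
  have hMc : M ≠ c := by rintro rfl; exact lt_irrefl _ hlt
  have huc : u c = 1 := by rw [hu, if_pos rfl]
  have huM : u M = 0 := by rw [hu, if_neg hMc]
  have hbest : ∀ c', IsSenderBest R u c' → ρ c' < mean R ρ := by
    intro c' h'
    rwa [(isSenderBest_indicator hc hu c').1 h']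
  have hd : 0 < ρ M - ρ c := by linarith
  have hex : ∃ p : Fin n × Fin n, IsParetoPair R ρ u p.1 p.2 := by
    refine ⟨(c, M), Or.inr ⟨hbest, hc, hMR, segment_subset_paretoCurve hc hu hMR hM hlt, ?_⟩⟩
    refine ⟨((ρ M - mean R ρ) / (ρ M - ρ c)) • (ρ c, u c) +
      ((mean R ρ - ρ c) / (ρ M - ρ c)) • (ρ M, u M), ⟨_, _, ?_, ?_, ?_, rfl⟩, ?_⟩
    · exact div_nonneg (by linarith) hd.le
    · exact div_nonneg (by linarith) hd.le
    · field_simp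
      ring
    · simp only [Prod.fst_add, Prod.smul_fst, smul_eq_mul]
      field_simp
      ring
  -- Every candidate other than `c` has utility 0 and is therefore dominated by `M`; injectivity of
  -- `ρ` excludes ties.
  have hend : ∀ a ∈ R, (ρ a, u a) ∈ paretoCurve R ρ u → a = c ∨ a = M := by
    intro a ha hmax
    by_contra hne
    push Not at hne
    have hle : ((ρ a, u a) : ℝ × ℝ) ≤ (ρ M, u M) := by
      refine ⟨hM a ha, ?_⟩
      simp only [huM, hu a, if_neg hne.1, le_refl]
    have := hmax.2 (subset_convexHull ℝ _ (Set.mem_image_of_mem _ hMR)) hle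
    exact hne.2 (hρ (le_antisymm (hM a ha) this.1))
  have key : ∀ p : Fin n × Fin n, IsParetoPair R ρ u p.1 p.2 →
      (p.1 = c ∧ p.2 = M) ∨ (p.1 = M ∧ p.2 = c) := by
    rintro ⟨a, b⟩ (⟨h1, h2, _⟩ | ⟨_, ha, hb, hseg, p, hp, hpm⟩)
    · exact absurd (hbest a h1) (not_lt.2 h2)
    · rcases hend a ha (hseg (left_mem_segment ℝ _ _)) with h1 | h1 <;>
      rcases hend b hb (hseg (right_mem_segment ℝ _ _)) with h2 | h2
      · rw [h1, h2, segment_same, Set.mem_singleton_iff] at hp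
        rw [hp] at hpm
        exact absurd hpm h.ne
      · exact Or.inl ⟨h1, h2⟩
      · exact Or.inr ⟨h1, h2⟩
      · rw [h1, h2, segment_same, Set.mem_singleton_iff] at hp
        rw [hp] at hpm
        exact absurd hpm hmean.ne'
  rw [paretoLottery, dif_pos hex]
  have hq0 : 0 ≤ (ρ M - mean R ρ) / (ρ M - ρ c) := div_nonneg (by linarith) hd.le
  have hq1 : (ρ M - mean R ρ) / (ρ M - ρ c) ≤ 1 := (div_le_one hd).2 (by linarith)
  rcases key _ hex.choose_spec with ⟨h1, h2⟩ | ⟨h1, h2⟩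
  · have hα : paretoAlpha R ρ u c M = (ρ M - mean R ρ) / (ρ M - ρ c) := by
      rw [paretoAlpha, if_neg hlt.ne, if_neg (by rw [huc, huM]; norm_num), ← neg_sub (ρ M),
        ← neg_sub (ρ M), neg_div_neg_eq]
    simp only [h1, h2, hα]
    rw [min_eq_right hq1, max_eq_right hq0]
    by_cases hic : i = c
    · subst hic
      simp [hMc.symm]
    · simp [hic]
  · have hα : paretoAlpha R ρ u M c = 1 - (ρ M - mean R ρ) / (ρ M - ρ c) := by
      rw [paretoAlpha, if_neg hlt.ne', if_neg (by rw [huc, huM]; norm_num)]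
      field_simp
      ring
    simp only [h1, h2, hα]
    rw [min_eq_right (by linarith), max_eq_right (by linarith)]
    by_cases hic : i = c
    · subst hic
      simp [hMc.symm]
    · simp [hic]

/-- The probability that the Pareto procedure on `R` returns the sender-optimal candidate `c`, if
`M` is receiver-optimal in `R`. -/
noncomputable def senderProb {n : ℕ} (R : Finset (Fin n)) (ρ : Fin n → ℝ) (c M : Fin n) : ℝ :=
  if mean R ρ ≤ ρ c then 1 else (ρ M - mean R ρ) / (ρ M - ρ c)

theorem sSup_image_eq {n : ℕ} {R : Finset (Fin n)} {ρ : Fin n → ℝ} {M : Fin n} (hMR : M ∈ R)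
    (hM : ∀ j ∈ R, ρ j ≤ ρ M) : sSup (ρ '' (R : Set (Fin n))) = ρ M := by
  refine IsGreatest.csSup_eq ⟨Set.mem_image_of_mem _ hMR, ?_⟩
  rintro _ ⟨j, hj, rfl⟩
  exact hM j hj

theorem mean_div {n : ℕ} (R : Finset (Fin n)) (ρ : Fin n → ℝ) (s : ℝ) :
    mean R (fun i => ρ i / s) = mean R ρ / s := by
  rw [mean, mean, ← Finset.sum_div, div_right_comm]

/-- The probabilities are ratios of differences of receiver values, so the scaling cancels. If all
values on `R` vanish, division by zero makes the scaled values 0, and the case where `c` reaches the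
average applies. -/
theorem ordinalParetoLottery_eq {n : ℕ} {ρ ξ : Fin n → ℝ} (h : IsInstance ρ ξ)
    {R : Finset (Fin n)} {c M : Fin n} (hc : IsSenderBest R ξ c) (hMR : M ∈ R)
    (hM : ∀ j ∈ R, ρ j ≤ ρ M) (i : Fin n) :
    ordinalParetoLottery ρ ξ R i = if i = c then senderProb R ρ c M else
      if i = M then 1 - senderProb R ρ c M else 0 := by
  have hu := ordinalUtility_eq h.xi_injective hc
  rw [ordinalParetoLottery, sSup_image_eq hMR hM]
  by_cases hle : mean R ρ ≤ ρ c
  · rw [paretoLottery_of_mean_le hc.1 hu, senderProb, if_pos hle]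
    · simp
    · rw [mean_div]
      exact div_le_div_of_nonneg_right hle (h.rho_nonneg M)
  · have hlt := not_le.1 hle
    have hs : 0 < ρ M :=
      ((h.rho_nonneg c).trans_lt hlt).trans_le (mean_le_of_le hMR hM)
    rw [paretoLottery_of_lt_mean hc.1 hu hMR (fun j hj => div_le_div_of_nonneg_right (hM j hj) hs.le)
      (fun a b hab => h.rho_injective ((div_left_inj' hs.ne').1 hab)), senderProb, if_neg hle,
      mean_div, ← sub_div, ← sub_div, div_div_div_cancel_right₀ hs.ne']
    rw [mean_div]
    exact div_lt_div_of_pos_right hlt hs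

theorem exists_isSenderBest {n : ℕ} {R : Finset (Fin n)} (hR : R.Nonempty) (ξ : Fin n → ℝ) :
    ∃ c, IsSenderBest R ξ c := by
  obtain ⟨c, hc, h⟩ := R.exists_max_image ξ hR
  exact ⟨c, hc, h⟩

theorem sum_ordinalParetoLottery_mul {n : ℕ} {ρ ξ : Fin n → ℝ} (h : IsInstance ρ ξ)
    {R : Finset (Fin n)} {c M : Fin n} (hc : IsSenderBest R ξ c) (hMR : M ∈ R)
    (hM : ∀ j ∈ R, ρ j ≤ ρ M) (w : Fin n → ℝ) :
    ∑ i ∈ R, ordinalParetoLottery ρ ξ R i * w i =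
      senderProb R ρ c M * w c + (1 - senderProb R ρ c M) * w M := by
  simp only [ordinalParetoLottery_eq h hc hMR hM]
  by_cases hcM : M = c
  · subst hcM
    have hP : senderProb R ρ M M = 1 := by
      rw [senderProb, if_pos (mean_le_of_le hMR hM)]
    simp [hP, hMR]
  · rw [Finset.sum_congr rfl fun i _ => show _ = (if i = c then senderProb R ρ c M * w c else 0) +
      (if i = M then (1 - senderProb R ρ c M) * w M else 0) from ?_]
    · rw [Finset.sum_add_distrib]
      simp [hc.1, hMR]
    · by_cases hi : i = c
      · subst hi
        simp [Ne.symm hcM]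
      · by_cases hi' : i = M
        · subst hi'
          simp [hi]
        · simp [hi, hi']

theorem sum_ordinalParetoLottery {n : ℕ} {ρ ξ : Fin n → ℝ} (h : IsInstance ρ ξ)
    {R : Finset (Fin n)} (hR : R.Nonempty) : ∑ i ∈ R, ordinalParetoLottery ρ ξ R i = 1 := by
  obtain ⟨c, hc⟩ := exists_isSenderBest hR ξ
  obtain ⟨M, hMR, hM⟩ := R.exists_max_image ρ hR
  have := sum_ordinalParetoLottery_mul h hc hMR hM fun _ => 1
  simpa using this

/-- The expected receiver value of the candidate returned by the Pareto procedure is at least the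
average. -/
theorem sum_le_card_mul_sum_ordinalParetoLottery {n : ℕ} {ρ ξ : Fin n → ℝ} (h : IsInstance ρ ξ)
    {R : Finset (Fin n)} (hR : R.Nonempty) :
    ∑ i ∈ R, ρ i ≤ R.card * ∑ i ∈ R, ordinalParetoLottery ρ ξ R i * ρ i := by
  obtain ⟨c, hc⟩ := exists_isSenderBest hR ξ
  obtain ⟨M, hMR, hM⟩ := R.exists_max_image ρ hR
  rw [sum_ordinalParetoLottery_mul h hc hMR hM]
  have hpos : (0 : ℝ) < R.card := by exact_mod_cast Finset.card_pos.2 hR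
  have hmean : ∑ i ∈ R, ρ i = R.card * mean R ρ := by
    rw [mean]
    field_simp
  rw [hmean]
  refine mul_le_mul_of_nonneg_left ?_ hpos.le
  -- The lottery's receiver value is `ρ c` if this reaches the average, and exactly the average
  -- otherwise.
  unfold senderProb
  split_ifs with hle
  · linarith
  · rw [not_le] at hle
    have hd : ρ M - ρ c ≠ 0 := by linarith [mean_le_of_le hMR hM]
    apply le_of_eq
    field_simp
    ring

theorem ordinalParetoLottery_mem {n : ℕ} (ρ ξ : Fin n → ℝ) (R : Finset (Fin n)) (i : Fin n) :
    0 ≤ ordinalParetoLottery ρ ξ R i ∧ ordinalParetoLottery ρ ξ R i ≤ 1 :=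
  paretoLottery_mem _ _ _ _

/-! ### Persuasiveness of the Shrinking Pareto mechanism -/

theorem sdiff_toFinset_cons {n : ℕ} {past : List (Fin n)} {R : Finset (Fin n)}
    (h : Finset.univ \ past.toFinset = R) (i : Fin n) :
    Finset.univ \ (i :: past).toFinset = R.erase i := by
  ext j
  simp [← h]

theorem shrinkingPareto_hireProb_of_mem {n : ℕ} (ρ ξ : Fin n → ℝ) (i : Fin n)
    (past : List (Fin n)) {σ : List Bool} (hσ : true ∈ σ) :
    (shrinkingPareto ρ ξ).hireProb (i :: past) σ = 0 := by
  simp [shrinkingPareto, shrinkingParetoHireProb, hσ]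

theorem shrinkingPareto_hireProb_of_notMem {n : ℕ} (ρ ξ : Fin n → ℝ) (i : Fin n)
    {past : List (Fin n)} {σ : List Bool} (hσ : true ∉ σ) {R : Finset (Fin n)}
    (h : Finset.univ \ past.toFinset = R) :
    (shrinkingPareto ρ ξ).hireProb (i :: past) σ = ordinalParetoLottery ρ ξ R i := by
  simp [shrinkingPareto, shrinkingParetoHireProb, hσ, ← h]

theorem sum_erase_eq_sub {n : ℕ} {R : Finset (Fin n)} {i : Fin n} (hi : i ∈ R) (v : Fin n → ℝ) :
    ∑ j ∈ R.erase i, v j = ∑ j ∈ R, v j - v i := by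
  rw [← Finset.add_sum_erase R v hi]; ring

theorem notMem_false_cons {σ : List Bool} (hσ : true ∉ σ) : true ∉ false :: σ := by
  simpa using hσ

/-- Without further HIRE signals no strategy gains more than the average. -/
theorem shrinkingPareto_remainingValue_le_mean {n : ℕ} {ρ ξ : Fin n → ℝ} (h : IsInstance ρ ξ)
    (r : Strategy n) (k : ℕ) (R : Finset (Fin n)) (hR : R.card = k) (past : List (Fin n))
    (σ : List Bool) (hσ : true ∈ σ) :
    remainingValue (shrinkingPareto ρ ξ) r ρ past σ k R ≤ (∑ i ∈ R, ρ i) / k := by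
  induction k generalizing R past σ with
  | zero => simp [remainingValue_zero]
  | succ k ih =>
    rw [remainingValue_succ _ _ _ _ _ _ _ hR]
    push_cast
    gcongr ?_ / _
    simp only [shrinkingPareto_hireProb_of_mem ρ ξ _ past hσ, zero_mul, zero_add, sub_zero, one_mul]
    split_ifs
    · exact le_rfl
    · have hS : 0 ≤ ∑ i ∈ R, ρ i := Finset.sum_nonneg fun i _ => h.rho_nonneg i
      calc _ ≤ ∑ i ∈ R, (∑ j ∈ R, ρ j - ρ i) / k := by
            refine Finset.sum_le_sum fun i hi => ?_
            rw [← sum_erase_eq_sub hi]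
            exact ih _ (card_erase_of_card_succ hR hi) _ _ (by simp [hσ])
        _ = k * (∑ i ∈ R, ρ i) / k := by
            rw [← Finset.sum_div, Finset.sum_sub_distrib, Finset.sum_const, hR, nsmul_eq_mul]
            push_cast
            ring
        _ ≤ ∑ i ∈ R, ρ i := by
            rcases Nat.eq_zero_or_pos k with rfl | hk
            · simpa using hS
            · have : (k : ℝ) ≠ 0 := by positivity
              rw [mul_div_cancel_left₀ _ this]

/-- Obedience gains at least the average. -/
theorem mean_le_shrinkingPareto_remainingValue {n : ℕ} {ρ ξ : Fin n → ℝ} (h : IsInstance ρ ξ)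
    (k : ℕ) (R : Finset (Fin n)) (hR : R.card = k) (past : List (Fin n)) (σ : List Bool)
    (hσ : true ∉ σ) (hpast : Finset.univ \ past.toFinset = R) :
    (∑ i ∈ R, ρ i) / k ≤ remainingValue (shrinkingPareto ρ ξ) obedient ρ past σ k R := by
  induction k generalizing R past σ with
  | zero => simp [remainingValue_zero]
  | succ k ih =>
    have hne : R.Nonempty := Finset.card_pos.1 (by omega)
    have hsum := sum_ordinalParetoLottery h hne
    have hmean := sum_le_card_mul_sum_ordinalParetoLottery h hne
    rw [remainingValue_obedient_succ _ _ _ _ _ _ hR]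
    push_cast
    gcongr ?_ / _
    simp only [shrinkingPareto_hireProb_of_notMem ρ ξ _ hσ hpast]
    set p := ordinalParetoLottery ρ ξ R with hp
    set A := ∑ i ∈ R, p i * ρ i with hA
    set S := ∑ i ∈ R, ρ i with hS
    rw [hR] at hmean
    push_cast at hmean
    rcases Nat.eq_zero_or_pos k with rfl | hk
    · simp only [remainingValue_zero, mul_zero, add_zero]
      simpa using hmean
    · have hk' : (0 : ℝ) < k := by exact_mod_cast hk
      have h1 : ∑ i ∈ R, (p i * ρ i + (1 - p i) * ((S - ρ i) / k)) = A + ((k - 1) * S + A) / k := by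
        have : ∀ i ∈ R, p i * ρ i + (1 - p i) * ((S - ρ i) / k) =
            p i * ρ i + (S - ρ i - p i * S + p i * ρ i) / k := by
          intro i _
          field_simp
          ring
        rw [Finset.sum_congr rfl this, Finset.sum_add_distrib, ← Finset.sum_div,
          Finset.sum_add_distrib, Finset.sum_sub_distrib, Finset.sum_sub_distrib, Finset.sum_const,
          ← Finset.sum_mul, hsum, hR, nsmul_eq_mul]
        push_cast
        ring
      -- The difference of the two sides is `((k + 1) * A - S) / k`, which is nonnegative because
      -- the lottery's value `A` is at least the average.
      calc S ≤ A + ((k - 1) * S + A) / k := by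
            rw [← sub_nonneg]
            have : A + ((k - 1) * S + A) / k - S = ((k + 1) * A - S) / k := by
              field_simp
              ring
            rw [this]
            exact div_nonneg (by linarith) hk'.le
        _ = _ := h1.symm
        _ ≤ _ := by
            refine Finset.sum_le_sum fun i hi => ?_
            gcongr
            · linarith [(ordinalParetoLottery_mem ρ ξ R i).2]
            · rw [← sum_erase_eq_sub hi]
              exact ih _ (card_erase_of_card_succ hR hi) _ _ (notMem_false_cons hσ)
                (sdiff_toFinset_cons hpast i)

theorem shrinkingPareto_remainingValue_le {n : ℕ} {ρ ξ : Fin n → ℝ} (h : IsInstance ρ ξ)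
    (r : Strategy n) (k : ℕ) (R : Finset (Fin n)) (hR : R.card = k) (past : List (Fin n))
    (σ : List Bool) (hσ : true ∉ σ) (hpast : Finset.univ \ past.toFinset = R) :
    remainingValue (shrinkingPareto ρ ξ) r ρ past σ k R ≤
      remainingValue (shrinkingPareto ρ ξ) obedient ρ past σ k R := by
  induction k generalizing R past σ with
  | zero => simp [remainingValue_zero]
  | succ k ih =>
    have hne : R.Nonempty := Finset.card_pos.1 (by omega)
    have hsum := sum_ordinalParetoLottery h hne
    have hmean := sum_le_card_mul_sum_ordinalParetoLottery h hne
    rw [remainingValue_obedient_succ _ _ _ _ _ _ hR, remainingValue_succ _ _ _ _ _ _ _ hR]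
    gcongr ?_ / _
    simp only [shrinkingPareto_hireProb_of_notMem ρ ξ _ hσ hpast]
    set p := ordinalParetoLottery ρ ξ R with hp
    rw [Finset.sum_add_distrib, Finset.sum_add_distrib]
    rw [hR] at hmean
    push_cast at hmean
    have hp0 : ∀ i, 0 ≤ p i := fun i => (ordinalParetoLottery_mem ρ ξ R i).1
    have hp1 : ∀ i, 0 ≤ 1 - p i := fun i => by linarith [(ordinalParetoLottery_mem ρ ξ R i).2]
    have hA : 0 ≤ ∑ i ∈ R, p i * ρ i :=
      Finset.sum_nonneg fun i _ => mul_nonneg (hp0 i) (h.rho_nonneg i)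
    -- The receiver decides before the arriving candidate is disclosed, so her decision is the same
    -- for all `i`. The HIRE and NOT contributions can thus be compared as whole sums, where only
    -- the average bound on the lottery is needed.
    refine add_le_add ?_ ?_
    · split_ifs
      · exact le_rfl
      · calc _ ≤ ∑ i ∈ R, p i * ((∑ j ∈ R, ρ j - ρ i) / k) := by
              refine Finset.sum_le_sum fun i hi => mul_le_mul_of_nonneg_left ?_ (hp0 i)
              rw [← sum_erase_eq_sub hi]
              exact shrinkingPareto_remainingValue_le_mean h r _ _
                (card_erase_of_card_succ hR hi) _ _ (by simp)
          _ = ((∑ i ∈ R, p i) * ∑ i ∈ R, ρ i - ∑ i ∈ R, p i * ρ i) / k := by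
              rw [Finset.sum_mul, ← Finset.sum_sub_distrib, Finset.sum_div]
              refine Finset.sum_congr rfl fun i _ => ?_
              ring
          _ ≤ _ := by
              rw [hsum, one_mul]
              rcases Nat.eq_zero_or_pos k with rfl | hk
              · simpa using hA
              · have hk' : (0 : ℝ) < k := by exact_mod_cast hk
                rw [div_le_iff₀ hk']
                linarith
    · have hcont : ∀ i ∈ R, (∑ j ∈ R, ρ j - ρ i) / k ≤ remainingValue (shrinkingPareto ρ ξ) obedient ρ
          (i :: past) (false :: σ) k (R.erase i) := by
        intro i hi
        rw [← sum_erase_eq_sub hi]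
        exact mean_le_shrinkingPareto_remainingValue h _ _ (card_erase_of_card_succ hR hi) _ _
          (notMem_false_cons hσ) (sdiff_toFinset_cons hpast i)
      split_ifs
      · calc ∑ i ∈ R, (1 - p i) * ρ i
            ≤ ∑ i ∈ R, (1 - p i) * ((∑ j ∈ R, ρ j - ρ i) / k) := by
              have h1 : ∑ i ∈ R, (1 - p i) * ρ i = ∑ i ∈ R, ρ i - ∑ i ∈ R, p i * ρ i := by
                rw [← Finset.sum_sub_distrib]
                exact Finset.sum_congr rfl fun i _ => by ring
              have h2 : ∑ i ∈ R, (1 - p i) * ((∑ j ∈ R, ρ j - ρ i) / k) =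
                  ((k - 1) * ∑ i ∈ R, ρ i + ∑ i ∈ R, p i * ρ i) / k := by
                have : ∀ i ∈ R, (1 - p i) * ((∑ j ∈ R, ρ j - ρ i) / k) =
                    ((∑ j ∈ R, ρ j) - ρ i - p i * (∑ j ∈ R, ρ j) + p i * ρ i) / k := by
                  intro i _
                  ring
                rw [Finset.sum_congr rfl this, ← Finset.sum_div,
                  Finset.sum_add_distrib, Finset.sum_sub_distrib, Finset.sum_sub_distrib,
                  Finset.sum_const, ← Finset.sum_mul, hsum, hR, nsmul_eq_mul]
                push_cast
                ring
              rw [h1, h2]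
              rcases Nat.eq_zero_or_pos k with rfl | hk
              · simpa using hmean
              · have hk' : (0 : ℝ) < k := by exact_mod_cast hk
                rw [le_div_iff₀ hk']
                linarith
          _ ≤ _ := Finset.sum_le_sum fun i hi => mul_le_mul_of_nonneg_left (hcont i hi) (hp1 i)
      · refine Finset.sum_le_sum fun i hi => mul_le_mul_of_nonneg_left ?_ (hp1 i)
        exact ih _ (card_erase_of_card_succ hR hi) _ _ (notMem_false_cons hσ)
          (sdiff_toFinset_cons hpast i)

theorem shrinkingPareto_persuasive {n : ℕ} {ρ ξ : Fin n → ℝ} (h : IsInstance ρ ξ) :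
    PersuasiveWithDisclosure ρ (shrinkingPareto ρ ξ) := by
  intro r
  rw [expectedValue_eq_remainingValue, expectedValue_eq_remainingValue]
  exact shrinkingPareto_remainingValue_le h r n _ (by simp) [] [] (by simp) (by simp)

/-! ### Success probability of the Shrinking Pareto mechanism -/

theorem IsSenderBest.erase {n : ℕ} {R : Finset (Fin n)} {ξ : Fin n → ℝ} {c i : Fin n}
    (hc : IsSenderBest R ξ c) (hi : i ≠ c) : IsSenderBest (R.erase i) ξ c :=
  ⟨Finset.mem_erase.2 ⟨hi.symm, hc.1⟩, fun j hj => hc.2 j (Finset.mem_of_mem_erase hj)⟩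

/-- The numerator is the total shortfall of `R` from `ρ M`. In this form the effect of deleting a
candidate is just a subtraction from that total. -/
theorem senderProb_eq_min {n : ℕ} {R : Finset (Fin n)} {ρ : Fin n → ℝ} {c M : Fin n} {m : ℝ}
    (hm : (R.card : ℝ) = m) (hm0 : 0 < m) (hd : 0 < ρ M - ρ c) :
    senderProb R ρ c M = min 1 ((m * ρ M - ∑ i ∈ R, ρ i) / (m * (ρ M - ρ c))) := by
  have hmean : mean R ρ = (∑ i ∈ R, ρ i) / m := by rw [mean, hm]
  have hmd : 0 < m * (ρ M - ρ c) := by positivity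
  rw [senderProb, hmean]
  split_ifs with h
  · rw [div_le_iff₀ hm0] at h
    rw [min_eq_left]
    rw [le_div_iff₀ hmd]
    linarith
  · rw [not_le, lt_div_iff₀ hm0] at h
    rw [min_eq_right]
    · field_simp
    · rw [div_le_iff₀ hmd]
      linarith

theorem ordinalParetoLottery_senderBest {n : ℕ} {ρ ξ : Fin n → ℝ} (h : IsInstance ρ ξ)
    {R : Finset (Fin n)} {c M : Fin n} (hc : IsSenderBest R ξ c) (hMR : M ∈ R)
    (hM : ∀ j ∈ R, ρ j ≤ ρ M) : ordinalParetoLottery ρ ξ R c = senderProb R ρ c M := by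
  rw [ordinalParetoLottery_eq h hc hMR hM, if_pos rfl]

theorem ordinalParetoLottery_eq_one {n : ℕ} {ρ ξ : Fin n → ℝ} (h : IsInstance ρ ξ)
    {R : Finset (Fin n)} {c : Fin n} (hc : IsSenderBest R ξ c) (hmean : mean R ρ ≤ ρ c) :
    ordinalParetoLottery ρ ξ R c = 1 := by
  obtain ⟨M, hMR, hM⟩ := R.exists_max_image ρ ⟨c, hc.1⟩
  rw [ordinalParetoLottery_senderBest h hc hMR hM, senderProb, if_pos hmean]

/-- Each summand is at least `1 - d i / (T - D)`, and the fractions `d i / (T - D)` sum to 1. -/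
theorem sub_two_le_sum_min {ι : Type*} (s : Finset ι) (d : ι → ℝ) (k D T : ℝ)
    (hk : 1 < k) (hD : 0 < D) (hd : ∀ i ∈ s, 0 ≤ d i)
    (hsum : ∑ i ∈ s, d i = T - D) (hcard : (s.card : ℝ) = k - 1) (hT : k * D ≤ T) :
    k - 2 ≤ ∑ i ∈ s, min 1 ((T - d i) / (k * D)) := by
  have hTD : 0 < T - D := by nlinarith
  have hkD : 0 < k * D := by positivity
  calc k - 2 = ∑ i ∈ s, (1 - d i / (T - D)) := by
        rw [Finset.sum_sub_distrib, ← Finset.sum_div, hsum, div_self hTD.ne', Finset.sum_const,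
          nsmul_eq_mul, hcard]
        ring
    _ ≤ _ := by
        refine Finset.sum_le_sum fun i hi => le_min ?_ ?_
        · have := div_nonneg (hd i hi) hTD.le
          linarith
        · have hdi : d i ≤ T - D := by
            rw [← hsum]
            exact Finset.single_le_sum hd hi
          have : 1 - d i / (T - D) = (T - D - d i) / (T - D) := by field_simp
          rw [this, div_le_div_iff₀ hTD hkD]
          have h1 : 0 ≤ (T - D - d i) * (T - k * D) := mul_nonneg (by linarith) (by linarith)
          have h2 : 0 ≤ D * d i := mul_nonneg hD.le (hd i hi)
          nlinarith

/-- Without the cap at 1 the sum is linear and equals `((k - 2) * T + D) / (k * D)`; clearing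
denominators leaves `(k - 2) * T ≤ (k ^ 2 - 1) * D`. -/
theorem le_sum_div {ι : Type*} (s : Finset ι) (d : ι → ℝ) (k D T : ℝ)
    (hk : 2 ≤ k) (hD : 0 < D) (hsum : ∑ i ∈ s, d i = T - D) (hcard : (s.card : ℝ) = k - 1)
    (hT : T ≤ k * D) :
    T / ((k + 1) * D) * ((k - 2) * k) ≤ (∑ i ∈ s, (T - d i) / (k * D)) * (k - 1) := by
  have h1 : ∑ i ∈ s, (T - d i) / (k * D) = ((k - 2) * T + D) / (k * D) := by
    rw [← Finset.sum_div, Finset.sum_sub_distrib, hsum, Finset.sum_const, nsmul_eq_mul, hcard]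
    ring
  rw [h1, div_mul_eq_mul_div, div_mul_eq_mul_div, div_le_div_iff₀ (by positivity) (by positivity)]
  have : 0 ≤ (k * D - T) * (k - 2) := mul_nonneg (by linarith) (by linarith)
  have h3 : 0 ≤ D * (k ^ 2 - 1) - (k - 2) * T := by nlinarith
  nlinarith [mul_nonneg h3 hD.le]

/-- The one-step inequality behind the factor `1/2 - 1/(2k)`. With the shortfalls `d i = ρ M - ρ i`,
`D` that of `c` and `T` their total over `R`, the lottery probability of `c` is `min 1 (T / ((k + 1)
* D))`, and deleting `i ≠ M` turns it into `min 1 ((T - d i) / (k * D))`. -/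
theorem ordinalParetoLottery_mul_le_sum_erase {n : ℕ} {ρ ξ : Fin n → ℝ} (h : IsInstance ρ ξ)
    {R : Finset (Fin n)} {c : Fin n} (hc : IsSenderBest R ξ c) {k : ℕ} (hk : 2 ≤ k)
    (hR : R.card = k + 1) :
    ordinalParetoLottery ρ ξ R c * (((k : ℝ) - 2) * k) ≤
      (∑ i ∈ R.erase c, (1 - ordinalParetoLottery ρ ξ R i) *
        ordinalParetoLottery ρ ξ (R.erase i) c) * ((k : ℝ) - 1) := by
  obtain ⟨M, hMR, hM⟩ := R.exists_max_image ρ ⟨c, hc.1⟩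
  have hk' : (2 : ℝ) ≤ k := by exact_mod_cast hk
  have hP0 := (ordinalParetoLottery_mem ρ ξ R c).1
  have hP1 := (ordinalParetoLottery_mem ρ ξ R c).2
  -- If `c` is also receiver-optimal, it stays so after every deletion, and all probabilities of `c`
  -- are 1.
  by_cases hMc : M = c
  · subst hMc
    have h1 : ∀ i ∈ R.erase M, (1 - ordinalParetoLottery ρ ξ R i) *
        ordinalParetoLottery ρ ξ (R.erase i) M = 1 := by
      intro i hi
      have hne := Finset.ne_of_mem_erase hi
      rw [ordinalParetoLottery_eq h hc hMR hM i, if_neg hne, if_neg hne,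
        ordinalParetoLottery_eq_one h (hc.erase hne)
          (mean_le_of_le (hc.erase hne).1 fun j hj => hM j (Finset.mem_of_mem_erase hj))]
      norm_num
    rw [Finset.sum_congr rfl h1, Finset.sum_const, card_erase_of_card_succ hR hMR, nsmul_eq_mul]
    have : 0 ≤ ((k : ℝ) - 2) * k := mul_nonneg (by linarith) (by linarith)
    nlinarith
  · have hD : 0 < ρ M - ρ c := by
      have := lt_of_le_of_ne (hM c hc.1) fun h' => hMc (h.rho_injective h').symm
      linarith
    have hMc' : M ∈ R.erase c := Finset.mem_erase.2 ⟨hMc, hMR⟩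
    set P := ordinalParetoLottery ρ ξ R c with hPdef
    have hpM : ordinalParetoLottery ρ ξ R M = 1 - P := by
      rw [hPdef, ordinalParetoLottery_eq h hc hMR hM, ordinalParetoLottery_eq h hc hMR hM]
      simp [hMc]
    set s := (R.erase c).erase M with hs
    set d : Fin n → ℝ := fun i => ρ M - ρ i with hd
    set D := ρ M - ρ c with hDdef
    set T := ((k : ℝ) + 1) * ρ M - ∑ i ∈ R, ρ i with hT
    have hcard : (s.card : ℝ) = k - 1 := by
      rw [hs, Finset.card_erase_of_mem hMc', Finset.card_erase_of_mem hc.1, hR]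
      rw [Nat.add_sub_cancel, Nat.cast_sub (by omega)]
      norm_num
    have hsum : ∑ i ∈ s, d i = T - D := by
      rw [hs, sum_erase_eq_sub hMc', sum_erase_eq_sub hc.1, hd, Finset.sum_sub_distrib,
        Finset.sum_const, hR, nsmul_eq_mul]
      push_cast
      simp only [hT, hDdef]
      ring
    have hd0 : ∀ i ∈ s, 0 ≤ d i := fun i hi => by
      have := hM i (Finset.mem_of_mem_erase (Finset.mem_of_mem_erase hi))
      simp only [hd]
      linarith
    have hmem : ∀ i ∈ s, i ≠ M ∧ i ≠ c ∧ i ∈ R := fun i hi =>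
      ⟨Finset.ne_of_mem_erase hi, Finset.ne_of_mem_erase (Finset.mem_of_mem_erase hi),
        Finset.mem_of_mem_erase (Finset.mem_of_mem_erase hi)⟩
    have hterm : ∀ i ∈ s, (1 - ordinalParetoLottery ρ ξ R i) *
        ordinalParetoLottery ρ ξ (R.erase i) c = min 1 ((T - d i) / (k * D)) := by
      intro i hi
      obtain ⟨h1, h2, h3⟩ := hmem i hi
      rw [ordinalParetoLottery_eq h hc hMR hM i, if_neg h2, if_neg h1,
        ordinalParetoLottery_senderBest h (hc.erase h2) (Finset.mem_erase.2 ⟨h1.symm, hMR⟩)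
          (fun j hj => hM j (Finset.mem_of_mem_erase hj)),
        senderProb_eq_min (m := k) (by rw [card_erase_of_card_succ hR h3]) (by linarith) hD,
        sum_erase_eq_sub h3, sub_zero, one_mul]
      congr 2
      simp only [hT, hd]
      ring
    rw [← Finset.add_sum_erase _ _ hMc', hpM, ← hs, Finset.sum_congr rfl hterm]
    have hPM0 := (ordinalParetoLottery_mem ρ ξ (R.erase M) c).1
    -- The condition `k * D ≤ T` says that `c` reaches the average once `M` is gone, so the summand
    -- of `M` is then exactly `P`. In the other case none of the minima is capped, and the summand
    -- of `M` can be dropped.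
    rcases le_or_gt (k * D) T with hcase | hcase
    · have h1 : ordinalParetoLottery ρ ξ (R.erase M) c = 1 := by
        refine ordinalParetoLottery_eq_one h (hc.erase hMc) ?_
        rw [mean, sum_erase_eq_sub hMR, card_erase_of_card_succ hR hMR, div_le_iff₀ (by linarith)]
        simp only [hT, hDdef] at hcase
        linarith
      have h2 := sub_two_le_sum_min s d k D T (by linarith) hD hd0 hsum hcard hcase
      rw [h1]
      calc P * (((k : ℝ) - 2) * k) ≤ (P + (k - 2)) * (k - 1) := by
            have : 0 ≤ ((k : ℝ) - 2) * (k - 1) * (1 - P) :=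
              mul_nonneg (mul_nonneg (by linarith) (by linarith)) (by linarith)
            nlinarith
        _ ≤ _ := by
            refine mul_le_mul_of_nonneg_right ?_ (by linarith)
            linarith
    · have h1 : ∀ i ∈ s, min 1 ((T - d i) / (k * D)) = (T - d i) / (k * D) := by
        intro i hi
        rw [min_eq_right]
        rw [div_le_one (by positivity)]
        linarith [hd0 i hi]
      have hP : P = T / (((k : ℝ) + 1) * D) := by
        rw [hPdef, ordinalParetoLottery_senderBest h hc hMR hM,
          senderProb_eq_min (m := (k : ℝ) + 1) (by rw [hR]; push_cast; rfl) (by linarith) hD,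
          min_eq_right]
        rw [div_le_one (by positivity)]
        nlinarith
      rw [Finset.sum_congr rfl h1]
      calc P * (((k : ℝ) - 2) * k) ≤ (∑ i ∈ s, (T - d i) / (k * D)) * (k - 1) := by
            rw [hP]
            exact le_sum_div s d k D T hk' hD hsum hcard hcase.le
        _ ≤ _ := by
            refine mul_le_mul_of_nonneg_right ?_ (by linarith)
            have : 0 ≤ (1 - (1 - P)) * ordinalParetoLottery ρ ξ (R.erase M) c :=
              mul_nonneg (by linarith) hPM0
            linarith

/-- Induction with the lottery probability of `c` on the current set as potential; arrivals of `c`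
that are rejected contribute nothing. -/
theorem le_shrinkingPareto_remainingValue {n : ℕ} {ρ ξ : Fin n → ℝ} (h : IsInstance ρ ξ)
    {c : Fin n} (k : ℕ) (hk : 1 ≤ k) (R : Finset (Fin n)) (hR : R.card = k)
    (hc : IsSenderBest R ξ c) (past : List (Fin n)) (σ : List Bool) (hσ : true ∉ σ)
    (hpast : Finset.univ \ past.toFinset = R) :
    ordinalParetoLottery ρ ξ R c * (1 / 2 - 1 / (2 * (k : ℝ))) ≤
      remainingValue (shrinkingPareto ρ ξ) obedient (fun i => if i = c then 1 else 0) past σ k R := by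
  have hv : ∀ i, (0 : ℝ) ≤ if i = c then 1 else 0 := fun i => by split_ifs <;> norm_num
  induction k, hk using Nat.le_induction generalizing R past σ with
  | base =>
    have := remainingValue_nonneg (shrinkingPareto ρ ξ) obedient _ hv past σ 1 R hR
    norm_num
    exact this
  | succ k hk ih =>
    have hk' : (1 : ℝ) ≤ k := by exact_mod_cast hk
    rw [remainingValue_obedient_succ _ _ _ _ _ _ hR]
    simp only [shrinkingPareto_hireProb_of_notMem ρ ξ _ hσ hpast]
    set p := ordinalParetoLottery ρ ξ R with hp
    have hp0 : ∀ i, 0 ≤ p i := fun i => (ordinalParetoLottery_mem ρ ξ R i).1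
    have hp1 : ∀ i, 0 ≤ 1 - p i := fun i => by linarith [(ordinalParetoLottery_mem ρ ξ R i).2]
    have hsum : ∑ i ∈ R, p i * (if i = c then (1 : ℝ) else 0) = p c := by
      simp [hc.1]
    rw [le_div_iff₀ (by linarith), Finset.sum_add_distrib, hsum, ← Finset.add_sum_erase _ _ hc.1]
    have hcterm := mul_nonneg (hp1 c) (remainingValue_nonneg (shrinkingPareto ρ ξ) obedient _ hv
      (c :: past) (false :: σ) k (R.erase c) (card_erase_of_card_succ hR hc.1))
    have hrest : (∑ i ∈ R.erase c, (1 - p i) * ordinalParetoLottery ρ ξ (R.erase i) c) *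
        (1 / 2 - 1 / (2 * (k : ℝ))) ≤ ∑ i ∈ R.erase c, (1 - p i) *
          remainingValue (shrinkingPareto ρ ξ) obedient (fun i => if i = c then 1 else 0)
            (i :: past) (false :: σ) k (R.erase i) := by
      rw [Finset.sum_mul]
      refine Finset.sum_le_sum fun i hi => ?_
      rw [mul_assoc]
      refine mul_le_mul_of_nonneg_left ?_ (hp1 i)
      exact ih _ (card_erase_of_card_succ hR (Finset.mem_of_mem_erase hi))
        (hc.erase (Finset.ne_of_mem_erase hi)) _ _ (notMem_false_cons hσ)
        (sdiff_toFinset_cons hpast i)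
    have hlhs : p c * (1 / 2 - 1 / (2 * ((k + 1 : ℕ) : ℝ))) * ((k : ℝ) + 1) = p c * (k / 2) := by
      push_cast
      field_simp
      ring
    rw [hlhs]
    -- For `k = 1` the inductive bound is 0, and the immediate hire of `c` suffices.
    rcases hk.eq_or_lt with rfl | hk2
    · norm_num at hrest ⊢
      nlinarith [hp0 c]
    · have hstep := ordinalParetoLottery_mul_le_sum_erase h hc hk2 hR
      rw [← hp] at hstep
      set X := ∑ i ∈ R.erase c, (1 - p i) * ordinalParetoLottery ρ ξ (R.erase i) c with hX
      have h1 : p c * ((k - 2) / 2) ≤ X * (1 / 2 - 1 / (2 * (k : ℝ))) := by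
        have : X * (1 / 2 - 1 / (2 * (k : ℝ))) = X * (k - 1) / (2 * k) := by
          field_simp
        rw [this, le_div_iff₀ (by positivity)]
        linarith
      linarith

/-! ### The upper bound on the benchmark -/

theorem expectedValue_hire_first {n : ℕ} (φ : Mechanism n) (v : Fin n → ℝ) :
    expectedValue φ (fun _ _ => true) v = mean Finset.univ v := by
  rw [expectedValue_eq_remainingValue]
  cases n with
  | zero => simp [remainingValue_zero, mean]
  | succ n =>
    rw [remainingValue_succ _ _ _ _ _ _ _ (by simp), mean]
    simp [← add_mul]

/-- Always hiring the first arrival is a signal-only strategy worth the average. Obedience is worth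
at most `ρ M` minus `ρ M - ρ c` times the success probability. Comparing the two bounds the success
probability. -/
theorem successProb_le_ordinalParetoLottery {n : ℕ} {ρ ξ : Fin n → ℝ} (h : IsInstance ρ ξ)
    {c : Fin n} (hc : IsSenderBest Finset.univ ξ c) (φ : Mechanism n)
    (hφ : PersuasiveWithoutDisclosure ρ φ) :
    successProb ξ φ ≤ ordinalParetoLottery ρ ξ Finset.univ c := by
  obtain ⟨M, hMR, hM⟩ := Finset.exists_max_image Finset.univ ρ ⟨c, hc.1⟩
  rw [ordinalParetoLottery_senderBest h hc hMR hM, senderProb]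
  split_ifs with hle
  · exact successProb_le_one ξ φ
  · rw [not_le] at hle
    have hD : 0 < ρ M - ρ c := by linarith [mean_le_of_le hMR hM]
    have h1 := hφ fun _ => true
    rw [expectedValue_hire_first] at h1
    have h2 : expectedValue φ obedient ρ ≤ expectedValue φ obedient
        (fun i => ρ M + (-(ρ M - ρ c)) * ordinalUtility Finset.univ ξ i) := by
      refine expectedValue_mono _ _ _ _ fun i => ?_
      rw [ordinalUtility_eq h.xi_injective hc]
      split_ifs with hi
      · rw [hi]; linarith
      · linarith [hM i (Finset.mem_univ i)]
    rw [expectedValue_linear] at h2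
    have h3 := expectedValue_const_le φ obedient (ρ M) (h.rho_nonneg M)
    rw [le_div_iff₀ hD]
    rw [successProb]
    linarith

theorem shrinkingPareto_successProb {n : ℕ} (hn : 1 ≤ n) {ρ ξ : Fin n → ℝ}
    (h : IsInstance ρ ξ) :
    OPT ρ ξ * (1 / 2 - 1 / (2 * (n : ℝ))) ≤ successProb ξ (shrinkingPareto ρ ξ) := by
  obtain ⟨c, hc⟩ := exists_isSenderBest (R := (Finset.univ : Finset (Fin n)))
    ⟨⟨0, hn⟩, Finset.mem_univ _⟩ ξ
  have hOPT : OPT ρ ξ ≤ ordinalParetoLottery ρ ξ Finset.univ c := by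
    refine Real.sSup_le ?_ (ordinalParetoLottery_mem _ _ _ _).1
    rintro _ ⟨φ, hφ, rfl⟩
    exact successProb_le_ordinalParetoLottery h hc φ hφ
  have hn' : (1 : ℝ) ≤ n := by exact_mod_cast hn
  have hg : (0 : ℝ) ≤ 1 / 2 - 1 / (2 * (n : ℝ)) := by
    rw [sub_nonneg]
    exact one_div_le_one_div_of_le (by norm_num) (by linarith)
  refine (mul_le_mul_of_nonneg_right hOPT hg).trans ?_
  have := le_shrinkingPareto_remainingValue h n hn Finset.univ (by simp) hc [] [] (by simp)
    (by simp)
  rwa [successProb, expectedValue_eq_remainingValue,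
    funext (ordinalUtility_eq h.xi_injective hc)]

/-! ### Mechanisms that recommend a candidate drawn in advance -/

/-- The mechanism that signals HIRE exactly when the candidate `x` arrives. -/
def targetMechanism {n : ℕ} (x : Fin n) : Mechanism n where
  hireProb θ _ := if θ.head? = some x then 1 else 0
  hireProb_nonneg θ σ := by split_ifs <;> norm_num
  hireProb_le_one θ σ := by split_ifs <;> norm_num

theorem targetMechanism_hireProb {n : ℕ} (x i : Fin n) (past : List (Fin n)) (σ : List Bool) :
    (targetMechanism x).hireProb (i :: past) σ = if i = x then 1 else 0 := by
  simp [targetMechanism]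

/-- The hiring probabilities of `lotteryMechanism`. -/
noncomputable def lotteryHireProb {n : ℕ} (c M : Fin n) (q : ℝ) : List (Fin n) → List Bool → ℝ
  | [], _ => 0
  | i :: past, σ =>
      if true ∈ σ then 0
      else if i = c then (if M ∈ past then 1 else q)
      else if i = M then (if c ∈ past then 1 else 1 - q)
      else 0

/-- The mechanism that draws `c` with probability `q` and `M` otherwise, and signals HIRE exactly
when the drawn candidate arrives. -/
noncomputable def lotteryMechanism {n : ℕ} (c M : Fin n) (q : ℝ) (hq0 : 0 ≤ q) (hq1 : q ≤ 1) :
    Mechanism n where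
  hireProb := lotteryHireProb c M q
  hireProb_nonneg θ σ := by
    cases θ with
    | nil => exact le_rfl
    | cons i past =>
      simp only [lotteryHireProb]
      split_ifs <;> linarith
  hireProb_le_one θ σ := by
    cases θ with
    | nil => exact zero_le_one
    | cons i past =>
      simp only [lotteryHireProb]
      split_ifs <;> linarith

theorem valueAlong_cons {n : ℕ} (φ : Mechanism n) (r : Strategy n) (v : Fin n → ℝ)
    (past : List (Fin n)) (σ : List Bool) (i : Fin n) (rest : List (Fin n)) :
    valueAlong φ r v past σ (i :: rest) =
      φ.hireProb (i :: past) σ * (if r past (true :: σ) then v i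
        else valueAlong φ r v (i :: past) (true :: σ) rest) +
      (1 - φ.hireProb (i :: past) σ) * (if r past (false :: σ) then v i
        else valueAlong φ r v (i :: past) (false :: σ) rest) := by
  simp [valueAlong, Mechanism.signalProb]

section Lottery

variable {n : ℕ} {c M : Fin n} {q : ℝ} (hq0 : 0 ≤ q) (hq1 : q ≤ 1) (r : Strategy n)
  (v : Fin n → ℝ)

theorem lotteryMechanism_hireProb (i : Fin n) (past : List (Fin n)) (σ : List Bool) :
    (lotteryMechanism c M q hq0 hq1).hireProb (i :: past) σ =
      if true ∈ σ then 0
      else if i = c then (if M ∈ past then 1 else q)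
      else if i = M then (if c ∈ past then 1 else 1 - q)
      else 0 := rfl

/-- Both mechanisms signal only NOT from here on: one has already recommended, the other's target no
longer arrives. -/
theorem valueAlong_lotteryMechanism_of_hired (x : Fin n) (l : List (Fin n)) (hx : x ∉ l)
    (past : List (Fin n)) (σ : List Bool) (hσ : true ∈ σ) :
    valueAlong (lotteryMechanism c M q hq0 hq1) r v past σ l =
      valueAlong (targetMechanism x) r v past σ l := by
  induction l generalizing past σ with
  | nil => rfl
  | cons i rest ih =>
    rw [List.mem_cons, not_or] at hx
    rw [valueAlong_cons, valueAlong_cons, lotteryMechanism_hireProb, targetMechanism_hireProb,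
      if_pos hσ, if_neg (Ne.symm hx.1), ih hx.2 _ (false :: σ) (by simp [hσ])]
    simp

theorem valueAlong_lotteryMechanism_right (hcM : c ≠ M) (l : List (Fin n)) (hl : l.Nodup)
    (hcl : c ∉ l) (past : List (Fin n)) (hc : c ∈ past) (σ : List Bool) (hσ : true ∉ σ) :
    valueAlong (lotteryMechanism c M q hq0 hq1) r v past σ l =
      valueAlong (targetMechanism M) r v past σ l := by
  induction l generalizing past σ with
  | nil => rfl
  | cons i rest ih =>
    rw [List.mem_cons, not_or] at hcl
    rw [List.nodup_cons] at hl
    rw [valueAlong_cons, valueAlong_cons, lotteryMechanism_hireProb, targetMechanism_hireProb,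
      if_neg hσ, if_neg (Ne.symm hcl.1), if_pos hc,
      ih hl.2 hcl.2 _ (by simp [hc]) _ (notMem_false_cons hσ)]
    by_cases hi : i = M
    · subst hi
      rw [valueAlong_lotteryMechanism_of_hired hq0 hq1 r v i rest hl.1 _ (true :: σ) (by simp)]
    · simp [hi]

theorem valueAlong_lotteryMechanism_left (hcM : c ≠ M) (l : List (Fin n)) (hl : l.Nodup)
    (hMl : M ∉ l) (past : List (Fin n)) (hM : M ∈ past) (σ : List Bool) (hσ : true ∉ σ) :
    valueAlong (lotteryMechanism c M q hq0 hq1) r v past σ l =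
      valueAlong (targetMechanism c) r v past σ l := by
  induction l generalizing past σ with
  | nil => rfl
  | cons i rest ih =>
    rw [List.mem_cons, not_or] at hMl
    rw [List.nodup_cons] at hl
    rw [valueAlong_cons, valueAlong_cons, lotteryMechanism_hireProb, targetMechanism_hireProb,
      if_neg hσ, if_neg (Ne.symm hMl.1), if_pos hM,
      ih hl.2 hMl.2 _ (by simp [hM]) _ (notMem_false_cons hσ)]
    by_cases hi : i = c
    · subst hi
      rw [valueAlong_lotteryMechanism_of_hired hq0 hq1 r v i rest hl.1 _ (true :: σ) (by simp)]
    · simp [hi]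

/-- The hiring probabilities are conditional on the signals so far: if one of the two candidates
passed with NOT, the other was drawn and must be recommended with certainty. Hence the mechanism is
the mixture of the two target mechanisms. -/
theorem valueAlong_lotteryMechanism (hcM : c ≠ M) (l : List (Fin n)) (hl : l.Nodup)
    (past : List (Fin n)) (hc : c ∉ past) (hM : M ∉ past) (σ : List Bool) (hσ : true ∉ σ) :
    valueAlong (lotteryMechanism c M q hq0 hq1) r v past σ l =
      q * valueAlong (targetMechanism c) r v past σ l +
        (1 - q) * valueAlong (targetMechanism M) r v past σ l := by
  induction l generalizing past σ with
  | nil => simp [valueAlong]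
  | cons i rest ih =>
    rw [List.nodup_cons] at hl
    rw [valueAlong_cons, valueAlong_cons, valueAlong_cons, lotteryMechanism_hireProb,
      targetMechanism_hireProb, targetMechanism_hireProb, if_neg hσ, if_neg hc, if_neg hM]
    by_cases hic : i = c
    · subst hic
      rw [valueAlong_lotteryMechanism_of_hired hq0 hq1 r v i rest hl.1 _ (true :: σ) (by simp),
        valueAlong_lotteryMechanism_right hq0 hq1 r v hcM rest hl.2 hl.1 _ (by simp) _
          (notMem_false_cons hσ)]
      simp [hcM]
    · by_cases hiM : i = M
      · subst hiM
        rw [valueAlong_lotteryMechanism_of_hired hq0 hq1 r v i rest hl.1 _ (true :: σ) (by simp),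
          valueAlong_lotteryMechanism_left hq0 hq1 r v hcM rest hl.2 hl.1 _ (by simp) _
            (notMem_false_cons hσ)]
        simp [hic]
        ring
      · rw [ih hl.2 (i :: past) (by simp [hc, Ne.symm hic]) (by simp [hM, Ne.symm hiM]) _
          (notMem_false_cons hσ)]
        simp only [hic, hiM, if_false, zero_mul, zero_add, sub_zero, one_mul]
        split_ifs <;> ring

theorem expectedValue_lotteryMechanism (hcM : c ≠ M) :
    expectedValue (lotteryMechanism c M q hq0 hq1) r v =
      q * expectedValue (targetMechanism c) r v +
        (1 - q) * expectedValue (targetMechanism M) r v := by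
  simp only [expectedValue_eq_avgOrders]
  rw [← avgOrders_const_mul, ← avgOrders_const_mul, ← avgOrders_add]
  exact avgOrders_congr n _ (by simp) _ _ fun l hl _ =>
    valueAlong_lotteryMechanism hq0 hq1 r v hcM l hl [] (by simp) (by simp) [] (by simp)

end Lottery

/-! ### Target mechanisms against obedient and signal-only receivers. -/

theorem valueAlong_targetMechanism_obedient {n : ℕ} (x : Fin n) (v : Fin n → ℝ)
    (l : List (Fin n)) (hx : x ∈ l) (past : List (Fin n)) (σ : List Bool) :
    valueAlong (targetMechanism x) obedient v past σ l = v x := by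
  induction l generalizing past σ with
  | nil => simp at hx
  | cons i rest ih =>
    rw [valueAlong_cons, targetMechanism_hireProb]
    simp only [obedient_cons]
    by_cases hi : i = x
    · simp [hi]
    · have := ih (by simpa [Ne.symm hi] using hx) (i :: past) (false :: σ)
      simp [hi, this]

theorem expectedValue_targetMechanism_obedient {n : ℕ} (x : Fin n) (v : Fin n → ℝ) :
    expectedValue (targetMechanism x) obedient v = v x := by
  rw [expectedValue_eq_avgOrders, ← avgOrders_const n (Finset.univ : Finset (Fin n)) (by simp) (v x)]
  refine avgOrders_congr n _ (by simp) _ _ fun l _ hl => ?_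
  refine valueAlong_targetMechanism_obedient x v l ?_ [] []
  rw [← List.mem_toFinset, hl]
  exact Finset.mem_univ x

/-- Without any HIRE signal, a receiver who only sees the signals hires in a fixed round. -/
theorem exists_remainingValue_targetMechanism_of_notMem {n : ℕ} (r : List Bool → Bool)
    (v : Fin n → ℝ) (k : ℕ) (σ : List Bool) : ∃ b : ℝ, 0 ≤ b ∧ b * k ≤ 1 ∧
      ∀ (x : Fin n) (R : Finset (Fin n)) (past : List (Fin n)), R.card = k → x ∉ R →
        remainingValue (targetMechanism x) (fun _ σ => r σ) v past σ k R = b * ∑ i ∈ R, v i := by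
  induction k generalizing σ with
  | zero =>
    refine ⟨0, le_rfl, by simp, fun x R past _ _ => ?_⟩
    simp [remainingValue_zero]
  | succ k ih =>
    obtain ⟨b, hb0, hb1, hb⟩ := ih (false :: σ)
    have hk : (0 : ℝ) < (k : ℝ) + 1 := by positivity
    have hstep : ∀ (x : Fin n) (R : Finset (Fin n)) (past : List (Fin n)), R.card = k + 1 →
        x ∉ R → remainingValue (targetMechanism x) (fun _ σ => r σ) v past σ (k + 1) R =
          (∑ i ∈ R, (if r (false :: σ) then v i else b * (∑ j ∈ R, v j - v i))) / ((k : ℝ) + 1) := by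
      intro x R past hR hx
      rw [remainingValue_succ _ _ _ _ _ _ _ hR]
      congr 1
      refine Finset.sum_congr rfl fun i hi => ?_
      have hix : i ≠ x := by rintro rfl; exact hx hi
      rw [targetMechanism_hireProb, if_neg hix, ← sum_erase_eq_sub hi,
        hb x _ (i :: past) (card_erase_of_card_succ hR hi) fun h => hx (Finset.mem_of_mem_erase h)]
      simp
    by_cases hr : r (false :: σ) = true
    · refine ⟨1 / ((k : ℝ) + 1), by positivity, ?_, fun x R past hR hx => ?_⟩
      · push_cast
        rw [one_div_mul_cancel hk.ne']
      · rw [hstep x R past hR hx]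
        simp only [hr, if_true]
        ring
    · refine ⟨b * k / ((k : ℝ) + 1), by positivity, ?_, fun x R past hR hx => ?_⟩
      · push_cast
        rwa [div_mul_cancel₀ _ hk.ne']
      · rw [hstep x R past hR hx]
        simp only [hr, Bool.false_eq_true, if_false]
        rw [← Finset.mul_sum, Finset.sum_sub_distrib, Finset.sum_const, hR, nsmul_eq_mul]
        push_cast
        ring

/-- A receiver who only sees the signals hires the target `x` with some probability `a`, and
every other candidate with the same probability `b`. -/
theorem exists_remainingValue_targetMechanism {n : ℕ} (r : List Bool → Bool)
    (v : Fin n → ℝ) (k : ℕ) (σ : List Bool) : ∃ a b : ℝ, 0 ≤ a ∧ 0 ≤ b ∧ a + b * k ≤ 1 ∧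
      ∀ (x : Fin n) (R : Finset (Fin n)) (past : List (Fin n)), R.card = k + 1 → x ∈ R →
        remainingValue (targetMechanism x) (fun _ σ => r σ) v past σ (k + 1) R =
          a * v x + b * (∑ i ∈ R, v i - v x) := by
  have hk : (0 : ℝ) < (k : ℝ) + 1 := by positivity
  -- The case in which the target arrives first; its total hiring probability is at most 1.
  have hx1 : ∃ a b : ℝ, 0 ≤ a ∧ 0 ≤ b ∧ a + b * k ≤ 1 ∧
      ∀ (x : Fin n) (R : Finset (Fin n)) (past : List (Fin n)), R.card = k + 1 → x ∈ R →
        (if r (true :: σ) then v x else remainingValue (targetMechanism x) (fun _ σ => r σ) v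
          (x :: past) (true :: σ) k (R.erase x)) = a * v x + b * (∑ i ∈ R, v i - v x) := by
    by_cases hr : r (true :: σ) = true
    · exact ⟨1, 0, zero_le_one, le_rfl, by simp, fun x R past _ _ => by simp [hr]⟩
    · obtain ⟨b, hb0, hb1, hb⟩ := exists_remainingValue_targetMechanism_of_notMem r v k (true :: σ)
      refine ⟨0, b, le_rfl, hb0, by simpa using hb1, fun x R past hR hx => ?_⟩
      rw [if_neg hr, hb x _ _ (card_erase_of_card_succ hR hx) (by simp), sum_erase_eq_sub hx]
      ring
  -- The `k` cases in which another candidate arrives first, added up; hence the bound `k` on the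
  -- total.
  have hx2 : ∃ a b : ℝ, 0 ≤ a ∧ 0 ≤ b ∧ a + b * k ≤ k ∧
      ∀ (x : Fin n) (R : Finset (Fin n)) (past : List (Fin n)), R.card = k + 1 → x ∈ R →
        ∑ i ∈ R.erase x, (if r (false :: σ) then v i
          else remainingValue (targetMechanism x) (fun _ σ => r σ) v
            (i :: past) (false :: σ) k (R.erase i)) = a * v x + b * (∑ i ∈ R, v i - v x) := by
    by_cases hr : r (false :: σ) = true
    · refine ⟨0, 1, le_rfl, zero_le_one, by simp, fun x R past _ hx => ?_⟩
      simp [hr, sum_erase_eq_sub hx]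
    · cases k with
      | zero =>
        refine ⟨0, 0, le_rfl, le_rfl, by simp, fun x R past hR hx => ?_⟩
        have := Finset.card_eq_zero.1 (card_erase_of_card_succ hR hx)
        simp [this]
      | succ k =>
        obtain ⟨a, b, ha0, hb0, hab, h⟩ :=
          exists_remainingValue_targetMechanism r v k (false :: σ)
        refine ⟨(k + 1) * a, k * b, by positivity, by positivity, ?_, fun x R past hR hx => ?_⟩
        · push_cast
          nlinarith
        · have hterm : ∀ i ∈ R.erase x, (if r (false :: σ) then v i
              else remainingValue (targetMechanism x) (fun _ σ => r σ) v
                (i :: past) (false :: σ) (k + 1) (R.erase i)) =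
                a * v x + b * (∑ j ∈ R, v j - v x - v i) := by
            intro i hi
            have hiR := Finset.mem_of_mem_erase hi
            rw [if_neg hr, h x _ _ (card_erase_of_card_succ hR hiR)
              (Finset.mem_erase.2 ⟨(Finset.ne_of_mem_erase hi).symm, hx⟩), sum_erase_eq_sub hiR]
            ring
          rw [Finset.sum_congr rfl hterm, Finset.sum_add_distrib, ← Finset.mul_sum _ _ b,
            Finset.sum_sub_distrib, Finset.sum_const, Finset.sum_const, sum_erase_eq_sub hx,
            card_erase_of_card_succ hR hx, nsmul_eq_mul, nsmul_eq_mul]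
          push_cast
          ring
  obtain ⟨a1, b1, ha1, hb1, hab1, h1⟩ := hx1
  obtain ⟨a2, b2, ha2, hb2, hab2, h2⟩ := hx2
  refine ⟨(a1 + a2) / ((k : ℝ) + 1), (b1 + b2) / ((k : ℝ) + 1), by positivity, by positivity, ?_,
    fun x R past hR hx => ?_⟩
  · rw [div_mul_eq_mul_div, ← add_div, div_le_one hk]
    linarith
  · rw [remainingValue_succ _ _ _ _ _ _ _ hR, ← Finset.add_sum_erase _ _ hx,
      targetMechanism_hireProb, if_pos rfl, h1 x R past hR hx]
    have hterm : ∀ i ∈ R.erase x, ((targetMechanism x).hireProb (i :: past) σ *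
          (if r (true :: σ) then v i else remainingValue (targetMechanism x) (fun _ σ => r σ) v
            (i :: past) (true :: σ) k (R.erase i)) +
        (1 - (targetMechanism x).hireProb (i :: past) σ) *
          (if r (false :: σ) then v i else remainingValue (targetMechanism x) (fun _ σ => r σ) v
            (i :: past) (false :: σ) k (R.erase i))) =
        (if r (false :: σ) then v i else remainingValue (targetMechanism x) (fun _ σ => r σ) v
            (i :: past) (false :: σ) k (R.erase i)) := by
      intro i hi
      rw [targetMechanism_hireProb, if_neg (Finset.ne_of_mem_erase hi)]
      ring
    rw [Finset.sum_congr rfl hterm, h2 x R past hR hx]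
    ring

/-- Whatever signal-only strategy is used, the target is hired with a probability `a` and each other
candidate with a probability `b`, the same for both targets. The value is then `a * A + b * (S -
A)`, with `A` the lottery's value and `S` the sum of all values, and `S - A ≤ k * A` because `A` is
at least the average. -/
theorem lotteryMechanism_persuasive {n : ℕ} {ρ : Fin n → ℝ} (hρ : ∀ i, 0 ≤ ρ i) {c M : Fin n}
    (hcM : c ≠ M) {q : ℝ} (hq0 : 0 ≤ q) (hq1 : q ≤ 1)
    (hsum : ∑ i, ρ i ≤ n * (q * ρ c + (1 - q) * ρ M)) :
    PersuasiveWithoutDisclosure ρ (lotteryMechanism c M q hq0 hq1) := by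
  intro r
  cases n with
  | zero => exact c.elim0
  | succ k =>
    obtain ⟨a, b, ha, hb, hab, h⟩ := exists_remainingValue_targetMechanism r ρ k []
    rw [expectedValue_lotteryMechanism hq0 hq1 _ _ hcM,
      expectedValue_lotteryMechanism hq0 hq1 _ _ hcM, expectedValue_targetMechanism_obedient,
      expectedValue_targetMechanism_obedient, expectedValue_eq_remainingValue,
      expectedValue_eq_remainingValue, h c _ [] (by simp) (Finset.mem_univ c),
      h M _ [] (by simp) (Finset.mem_univ M)]
    push_cast at hsum
    set A := q * ρ c + (1 - q) * ρ M with hA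
    have hA0 : 0 ≤ A :=
      add_nonneg (mul_nonneg hq0 (hρ c)) (mul_nonneg (by linarith) (hρ M))
    calc _ = a * A + b * (∑ i, ρ i - A) := by rw [hA]; ring
      _ ≤ a * A + b * (k * A) := by
          gcongr
          linarith
      _ = (a + b * k) * A := by ring
      _ ≤ A := mul_le_of_le_one_left hA0 hab

theorem le_OPT {n : ℕ} {ρ ξ : Fin n → ℝ} (h : IsInstance ρ ξ) {c M : Fin n}
    (hc : IsSenderBest Finset.univ ξ c) (hcM : c ≠ M) {q : ℝ} (hq0 : 0 ≤ q) (hq1 : q ≤ 1)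
    (hsum : ∑ i, ρ i ≤ n * (q * ρ c + (1 - q) * ρ M)) : q ≤ OPT ρ ξ := by
  refine le_csSup ⟨1, ?_⟩ ⟨lotteryMechanism c M q hq0 hq1,
    lotteryMechanism_persuasive h.rho_nonneg hcM hq0 hq1 hsum, ?_⟩
  · rintro _ ⟨φ, _, rfl⟩
    exact successProb_le_one ξ φ
  · rw [successProb, expectedValue_lotteryMechanism hq0 hq1 _ _ hcM,
      expectedValue_targetMechanism_obedient, expectedValue_targetMechanism_obedient,
      ordinalUtility_eq h.xi_injective hc, ordinalUtility_eq h.xi_injective hc, if_pos rfl,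
      if_neg hcM.symm]
    ring

/-! ### Instances on which disclosure costs half of the success probability -/

/-- As long as the candidate `c` has not been rejected, refuse the first HIRE signal and hire in the
next round. Obey once `c` has been rejected after NOT signals only. -/
def delayStrategy {n : ℕ} (c : Fin n) : Strategy n
  | _, [] => false
  | past, s :: σ => if true ∈ σ then true else if c ∈ past then s else false

theorem delayStrategy_cons {n : ℕ} (c : Fin n) (past : List (Fin n)) (s : Bool) (σ : List Bool) :
    delayStrategy c past (s :: σ) = if true ∈ σ then true else if c ∈ past then s else false := rfl

theorem valueAlong_delayStrategy_of_mem {n : ℕ} (φ : Mechanism n) (v : Fin n → ℝ) (c : Fin n)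
    (l past : List (Fin n)) (hc : c ∈ past) (σ : List Bool) (hσ : true ∉ σ) :
    valueAlong φ (delayStrategy c) v past σ l = valueAlong φ obedient v past σ l := by
  induction l generalizing past σ with
  | nil => rfl
  | cons i rest ih =>
    rw [valueAlong_cons, valueAlong_cons, delayStrategy_cons, delayStrategy_cons, obedient_cons,
      obedient_cons, if_neg hσ, if_pos hc, if_neg hσ, if_pos hc,
      ih (i :: past) (by simp [hc]) _ (notMem_false_cons hσ)]
    simp

theorem remainingValue_delayStrategy_of_mem {n : ℕ} (φ : Mechanism n) (v : Fin n → ℝ) (c : Fin n)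
    (past : List (Fin n)) (hc : c ∈ past) (σ : List Bool) (hσ : true ∉ σ) (k : ℕ)
    (R : Finset (Fin n)) :
    remainingValue φ (delayStrategy c) v past σ k R = remainingValue φ obedient v past σ k R := by
  unfold remainingValue
  congr 1
  ext l
  exact valueAlong_delayStrategy_of_mem φ v c l past hc σ hσ

/-- After a refused HIRE the next arrival, a uniformly random remaining candidate, is hired. -/
theorem remainingValue_delayStrategy_of_hire {n : ℕ} (φ : Mechanism n) (v : Fin n → ℝ) (c : Fin n)
    (past : List (Fin n)) (σ : List Bool) (hσ : true ∈ σ) (k : ℕ) (R : Finset (Fin n))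
    (hR : R.card = k) :
    remainingValue φ (delayStrategy c) v past σ k R = (∑ i ∈ R, v i) / k := by
  cases k with
  | zero => simp [remainingValue_zero]
  | succ k =>
    rw [remainingValue_succ _ _ _ _ _ _ _ hR]
    push_cast
    congr 1
    refine Finset.sum_congr rfl fun i _ => ?_
    rw [delayStrategy_cons, delayStrategy_cons, if_pos hσ, if_pos rfl, if_pos hσ, if_pos rfl]
    ring

theorem remainingValue_indicator_of_notMem {n : ℕ} (φ : Mechanism n) (c : Fin n) (k : ℕ)
    (R : Finset (Fin n)) (hR : R.card = k) (hc : c ∉ R) (past : List (Fin n)) (σ : List Bool) :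
    remainingValue φ obedient (fun i => if i = c then 1 else 0) past σ k R = 0 := by
  induction k generalizing R past σ with
  | zero => rfl
  | succ k ih =>
    rw [remainingValue_obedient_succ _ _ _ _ _ _ hR, Finset.sum_eq_zero, zero_div]
    intro i hi
    have hic : i ≠ c := by rintro rfl; exact hc hi
    rw [ih _ (card_erase_of_card_succ hR hi) (fun h => hc (Finset.mem_of_mem_erase h)), if_neg hic]
    ring

/-- The gain of obedience over `delayStrategy c` is small compared to the success probability. -/
theorem remainingValue_sub_delayStrategy_le {n : ℕ} (φ : Mechanism n) {ρ : Fin n → ℝ}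
    {c M : Fin n} (hcM : c ≠ M) {v δ h : ℝ} (hv : 0 ≤ v) (hδ : 0 ≤ δ) (hh : 0 ≤ h)
    (hρc : ρ c = 0) (hρ : ∀ j, j ≠ c → v ≤ ρ j) (hρM : ρ M ≤ v + h)
    (hρ' : ∀ j, j ≠ c → j ≠ M → ρ j ≤ v + δ) (k : ℕ) (R : Finset (Fin n)) (hR : R.card = k + 1)
    (hcR : c ∈ R) (past : List (Fin n)) (hc : c ∉ past) (σ : List Bool) (hσ : true ∉ σ) :
    remainingValue φ obedient ρ past σ (k + 1) R -
        remainingValue φ (delayStrategy c) ρ past σ (k + 1) R +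
        v * remainingValue φ obedient (fun i => if i = c then 1 else 0) past σ (k + 1) R ≤
      2 * v / ((k : ℝ) + 1) + (if M ∈ R then h / 2 else 0) + δ := by
  induction k generalizing R past σ with
  | zero =>
    obtain ⟨x, rfl⟩ := Finset.card_eq_one.1 hR
    obtain rfl := Finset.mem_singleton.1 hcR
    rw [remainingValue_obedient_succ _ _ _ _ _ _ hR, remainingValue_obedient_succ _ _ _ _ _ _ hR,
      remainingValue_succ _ _ _ _ _ _ _ hR]
    simp only [remainingValue_zero, delayStrategy_cons, if_neg hσ, if_neg hc]
    -- If `c` is the last arrival, refusing it leaves nobody to hire; the term `2 * v` absorbs this.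
    have h1 := mul_le_mul_of_nonneg_left (φ.hireProb_le_one [] []) hv
    have h2 := mul_le_mul_of_nonneg_left (φ.hireProb_le_one (c :: past) σ) hv
    simp [hρc, hcM.symm]
    linarith
  | succ k ih =>
    have hk : (0 : ℝ) < (k : ℝ) + 1 := by positivity
    have hk2 : (0 : ℝ) < ((k + 1 : ℕ) : ℝ) + 1 := by positivity
    rw [remainingValue_obedient_succ _ _ _ _ _ _ hR, remainingValue_obedient_succ _ _ _ _ _ _ hR,
      remainingValue_succ _ _ _ _ _ _ _ hR]
    simp only [delayStrategy_cons, if_neg hσ, if_neg hc, Bool.false_eq_true, if_false]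
    rw [← mul_div_assoc, ← sub_div, ← add_div, div_le_iff₀ hk2, ← Finset.sum_sub_distrib,
      Finset.mul_sum, ← Finset.sum_add_distrib, ← Finset.add_sum_erase _ _ hcR]
    have hRc := card_erase_of_card_succ hR hcR
    -- When `c` arrives with HIRE, obedience earns 0 and the delay at least `v`, which pays for the
    -- success term. With NOT, the two strategies coincide from then on and `c` is lost.
    have hcterm : φ.hireProb (c :: past) σ * ρ c + (1 - φ.hireProb (c :: past) σ) *
          remainingValue φ obedient ρ (c :: past) (false :: σ) (k + 1) (R.erase c) -
        (φ.hireProb (c :: past) σ *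
          remainingValue φ (delayStrategy c) ρ (c :: past) (true :: σ) (k + 1) (R.erase c) +
        (1 - φ.hireProb (c :: past) σ) *
          remainingValue φ (delayStrategy c) ρ (c :: past) (false :: σ) (k + 1) (R.erase c)) +
        v * (φ.hireProb (c :: past) σ * (if c = c then 1 else 0) +
          (1 - φ.hireProb (c :: past) σ) * remainingValue φ obedient
            (fun i => if i = c then 1 else 0) (c :: past) (false :: σ) (k + 1) (R.erase c)) ≤ 0 := by
      rw [remainingValue_delayStrategy_of_mem φ ρ c (c :: past) (by simp) _ (notMem_false_cons hσ),
        remainingValue_delayStrategy_of_hire φ ρ c (c :: past) (true :: σ) (by simp) _ _ hRc,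
        remainingValue_indicator_of_notMem φ c _ _ hRc (by simp), if_pos rfl, hρc]
      have h1 : v ≤ (∑ i ∈ R.erase c, ρ i) / ((k + 1 : ℕ) : ℝ) := by
        rw [le_div_iff₀ (by positivity), ← hRc, mul_comm, ← nsmul_eq_mul]
        exact Finset.card_nsmul_le_sum _ _ _ fun i hi => hρ i (Finset.ne_of_mem_erase hi)
      have := mul_le_mul_of_nonneg_left h1 (φ.hireProb_nonneg (c :: past) σ)
      linarith
    -- Delaying at `i ≠ c` costs at most `v / (k + 1)`, the risk of drawing the worthless `c`, plus
    -- `δ`, or plus `h` if `i = M`. The bound for `M` splits as `h / 2 + h / 2`: the extra half,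
    -- together with the vanishing contribution of `c`, keeps the average at `h / 2`. This reflects
    -- that `M` precedes `c` with probability 1/2.
    have hterm : ∀ i ∈ R.erase c, φ.hireProb (i :: past) σ * ρ i + (1 - φ.hireProb (i :: past) σ) *
          remainingValue φ obedient ρ (i :: past) (false :: σ) (k + 1) (R.erase i) -
        (φ.hireProb (i :: past) σ *
          remainingValue φ (delayStrategy c) ρ (i :: past) (true :: σ) (k + 1) (R.erase i) +
        (1 - φ.hireProb (i :: past) σ) *
          remainingValue φ (delayStrategy c) ρ (i :: past) (false :: σ) (k + 1) (R.erase i)) +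
        v * (φ.hireProb (i :: past) σ * (if i = c then 1 else 0) +
          (1 - φ.hireProb (i :: past) σ) * remainingValue φ obedient
            (fun i => if i = c then 1 else 0) (i :: past) (false :: σ) (k + 1) (R.erase i)) ≤
        (2 * v / ((k : ℝ) + 1) + (if M ∈ R then h / 2 else 0) + δ) + if i = M then h / 2 else 0 := by
      intro i hi
      have hiR := Finset.mem_of_mem_erase hi
      have hic := Finset.ne_of_mem_erase hi
      have hRi := card_erase_of_card_succ hR hiR
      have hci : c ∈ R.erase i := Finset.mem_erase.2 ⟨hic.symm, hcR⟩
      rw [remainingValue_delayStrategy_of_hire φ ρ c (i :: past) (true :: σ) (by simp) _ _ hRi,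
        if_neg hic]
      have hp0 := φ.hireProb_nonneg (i :: past) σ
      have hp1 := φ.hireProb_le_one (i :: past) σ
      have hIH := ih _ hRi hci (i :: past) (by simp [hc, hic.symm]) _ (notMem_false_cons hσ)
      have h1 : ρ i - (∑ j ∈ R.erase i, ρ j) / ((k + 1 : ℕ) : ℝ) ≤
          (2 * v / ((k : ℝ) + 1) + (if M ∈ R then h / 2 else 0) + δ) +
            if i = M then h / 2 else 0 := by
        have h2 : (k : ℝ) * v ≤ ∑ j ∈ R.erase i, ρ j := by
          rw [← Finset.add_sum_erase _ _ hci, hρc, zero_add,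
            ← card_erase_of_card_succ hRi hci, ← nsmul_eq_mul]
          exact Finset.card_nsmul_le_sum _ _ _ fun j hj => hρ j (Finset.ne_of_mem_erase hj)
        have h3 : (k : ℝ) * v / ((k : ℝ) + 1) ≤ (∑ j ∈ R.erase i, ρ j) / ((k + 1 : ℕ) : ℝ) := by
          push_cast
          gcongr
        have h4 : (k : ℝ) * v / ((k : ℝ) + 1) = v - v / ((k : ℝ) + 1) := by
          field_simp
          ring
        have h5 : 2 * v / ((k : ℝ) + 1) = v / ((k : ℝ) + 1) + v / ((k : ℝ) + 1) := by ring
        have h6 : 0 ≤ v / ((k : ℝ) + 1) := by positivity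
        by_cases hiM : i = M
        · subst hiM
          rw [if_pos hiR, if_pos rfl]
          linarith
        · have := hρ' i hic hiM
          have h7 : 0 ≤ if M ∈ R then h / 2 else 0 := by split_ifs <;> linarith
          rw [if_neg hiM]
          linarith
      have h8 : remainingValue φ obedient ρ (i :: past) (false :: σ) (k + 1) (R.erase i) -
          remainingValue φ (delayStrategy c) ρ (i :: past) (false :: σ) (k + 1) (R.erase i) +
          v * remainingValue φ obedient (fun i => if i = c then 1 else 0) (i :: past) (false :: σ)
            (k + 1) (R.erase i) ≤
          (2 * v / ((k : ℝ) + 1) + (if M ∈ R then h / 2 else 0) + δ) +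
            if i = M then h / 2 else 0 := by
        have h9 : (if M ∈ R.erase i then h / 2 else 0) ≤ if M ∈ R then h / 2 else 0 := by
          by_cases hMi : M ∈ R.erase i
          · rw [if_pos hMi, if_pos (Finset.mem_of_mem_erase hMi)]
          · rw [if_neg hMi]
            split_ifs <;> linarith
        have h10 : 0 ≤ if i = M then h / 2 else 0 := by split_ifs <;> linarith
        linarith
      have h11 := mul_le_mul_of_nonneg_left h1 hp0
      have h12 := mul_le_mul_of_nonneg_left h8 (sub_nonneg.2 hp1)
      linarith
    refine (add_le_add hcterm (Finset.sum_le_sum hterm)).trans ?_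
    rw [zero_add, Finset.sum_add_distrib, Finset.sum_const, hRc, nsmul_eq_mul,
      Finset.sum_ite_eq' (R.erase c) M]
    have h13 : (if M ∈ R.erase c then h / 2 else 0) = if M ∈ R then h / 2 else 0 := by
      simp [hcM.symm]
    rw [h13]
    push_cast
    have h14 : ((k : ℝ) + 1) * (2 * v / ((k : ℝ) + 1)) = 2 * v := by field_simp
    have h15 : 2 * v / ((k : ℝ) + 1 + 1) * ((k : ℝ) + 1 + 1) = 2 * v := by field_simp
    -- The `k + 1` arrivals other than `c` contribute `2 * v / (k + 1)` each, in total `2 * v`,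
    -- which is `2 * v / (k + 2)` per arrival.
    nlinarith

theorem mul_successProb_le {n : ℕ} {φ : Mechanism n} {ρ ξ : Fin n → ℝ}
    (hinst : IsInstance ρ ξ) (hφ : PersuasiveWithDisclosure ρ φ) {c M : Fin n} (hcM : c ≠ M)
    (hc : IsSenderBest Finset.univ ξ c) {v δ h : ℝ} (hv : 0 ≤ v) (hδ : 0 ≤ δ) (hh : 0 ≤ h)
    (hρc : ρ c = 0) (hρ : ∀ j, j ≠ c → v ≤ ρ j) (hρM : ρ M ≤ v + h)
    (hρ' : ∀ j, j ≠ c → j ≠ M → ρ j ≤ v + δ) :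
    v * successProb ξ φ ≤ 2 * v / n + h / 2 + δ := by
  cases n with
  | zero => exact c.elim0
  | succ k =>
    have h1 := remainingValue_sub_delayStrategy_le φ hcM hv hδ hh hρc hρ hρM hρ' k Finset.univ
      (by simp) (Finset.mem_univ c) [] (by simp) [] (by simp)
    have h2 := hφ (delayStrategy c)
    rw [expectedValue_eq_remainingValue, expectedValue_eq_remainingValue] at h2
    rw [successProb, expectedValue_eq_remainingValue,
      funext (ordinalUtility_eq hinst.xi_injective hc)]
    rw [if_pos (Finset.mem_univ M)] at h1
    push_cast
    linarith

/-- Receiver values for which disclosure costs half of the success probability. -/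
noncomputable def hardValue (n : ℕ) (h : ℝ) (i : Fin n) : ℝ :=
  if (i : ℕ) = 0 then 0 else if (i : ℕ) = 1 then 1 else 1 - h + (i : ℝ) / (n : ℝ) ^ 2

theorem div_sq_lt {n : ℕ} (i : Fin n) : (i : ℝ) / (n : ℝ) ^ 2 < 1 / n := by
  have hi : (i : ℝ) < n := by exact_mod_cast i.2
  have hn : (0 : ℝ) < n := (Nat.cast_nonneg _).trans_lt hi
  rw [div_lt_div_iff₀ (by positivity) hn]
  nlinarith

/-- The perturbation `i / n ^ 2` only separates the ordinary candidates; being below `1 / n < h`, it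
keeps them strictly under the value 1. -/
theorem hardValue_isInstance {n : ℕ} {h : ℝ} (h1 : h < 1) (hn : 1 / (n : ℝ) < h) :
    IsInstance (hardValue n h) (fun i => (n : ℝ) - i) where
  rho_nonneg i := by
    unfold hardValue
    have : (0 : ℝ) ≤ (i : ℝ) / (n : ℝ) ^ 2 := by positivity
    split_ifs <;> linarith
  xi_nonneg i := by
    have hi : (i : ℝ) < n := by exact_mod_cast i.2
    linarith
  rho_injective i j hij := by
    have hpos : (0 : ℝ) < n := by exact_mod_cast (Nat.zero_le _).trans_lt i.2
    have hi : (0 : ℝ) ≤ (i : ℝ) / (n : ℝ) ^ 2 := by positivity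
    have hj : (0 : ℝ) ≤ (j : ℝ) / (n : ℝ) ^ 2 := by positivity
    have hi' := div_sq_lt i
    have hj' := div_sq_lt j
    unfold hardValue at hij
    split_ifs at hij <;> first
      | (exfalso; linarith)
      | (ext; omega)
      | skip
    have h2 : (i : ℝ) / (n : ℝ) ^ 2 = (j : ℝ) / (n : ℝ) ^ 2 := by linarith
    have h3 : (i : ℝ) = j := (div_left_inj' (by positivity)).1 h2
    ext
    exact_mod_cast h3
  xi_injective i j hij := by
    have h3 : (i : ℝ) = j := by
      simp only at hij
      linarith
    ext
    exact_mod_cast h3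

/-- One `1 / n` of the slack covers the perturbations, the other the single candidate of value 1.
The bound is the condition of `le_OPT` for `q = h - 2 / n`. -/
theorem sum_hardValue_le {n : ℕ} {h : ℝ} (h1 : h ≤ 1) (hn : 2 ≤ n) :
    ∑ i, hardValue n h i ≤ n * (1 - (h - 2 / n)) := by
  have hpos : (0 : ℝ) < n := by exact_mod_cast (by omega : 0 < n)
  have hterm : ∀ i ∈ (Finset.univ : Finset (Fin n)), hardValue n h i ≤
      (1 - h + 1 / n) + if i = (⟨1, hn⟩ : Fin n) then 1 else 0 := by
    intro i _
    have h2 : (0 : ℝ) < 1 / n := by positivity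
    have h3 := div_sq_lt i
    unfold hardValue
    simp only [Fin.ext_iff]
    split_ifs with h4 h5 <;> first | omega | linarith
  refine (Finset.sum_le_sum hterm).trans ?_
  rw [Finset.sum_add_distrib, Finset.sum_const, Finset.sum_ite_eq']
  simp only [Finset.card_univ, Fintype.card_fin, nsmul_eq_mul, Finset.mem_univ, if_true]
  apply le_of_eq
  field_simp
  ring

theorem exists_hard_instance (ε : ℝ) (hε : 0 < ε) : ∃ N : ℕ, ∀ n : ℕ, N ≤ n →
    ∃ ρ ξ : Fin n → ℝ, IsInstance ρ ξ ∧ ∀ φ : Mechanism n, PersuasiveWithDisclosure ρ φ →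
      successProb ξ φ ≤ (1 / 2 + ε) * OPT ρ ξ := by
  obtain ⟨h, h0, h1, h2⟩ : ∃ h : ℝ, 0 < h ∧ h ≤ 1 / 2 ∧ h ≤ ε / 2 :=
    ⟨min (1 / 2) (ε / 2), by positivity, min_le_left _ _, min_le_right _ _⟩
  -- The first summand makes the error terms of order `1 / n` negligible against `ε * h`; the second
  -- makes `h - 2 / n` positive.
  obtain ⟨N, hN⟩ := exists_nat_gt ((10 + 4 * ε) / (ε * h) + 2 / h)
  have hN1 : 0 < (10 + 4 * ε) / (ε * h) := by positivity
  have hN2 : 0 < 2 / h := by positivity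
  refine ⟨max N 2, fun n hn => ?_⟩
  have hn2 : 2 ≤ n := (le_max_right _ _).trans hn
  have hnN : (N : ℝ) ≤ n := by exact_mod_cast (le_max_left _ _).trans hn
  have hpos : (0 : ℝ) < n := by exact_mod_cast (by omega : 0 < n)
  have hnh : 2 / (n : ℝ) < h := by
    rw [div_lt_comm₀ hpos h0]
    linarith
  have hnε : (10 + 4 * ε) / n < ε * h := by
    rw [div_lt_comm₀ hpos (by positivity)]
    linarith
  have hn1 : 0 < 1 / (n : ℝ) := by positivity
  have hdouble : 2 / (n : ℝ) = 2 * (1 / n) := by ring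
  have hinst := hardValue_isInstance (n := n) (h := h) (by linarith) (by linarith)
  refine ⟨hardValue n h, fun i => (n : ℝ) - i, hinst, fun φ hφ => ?_⟩
  set c : Fin n := ⟨0, by omega⟩ with hc
  set M : Fin n := ⟨1, by omega⟩ with hM
  have hcM : c ≠ M := by simp [hc, hM, Fin.ext_iff]
  have hbest : IsSenderBest Finset.univ (fun i : Fin n => (n : ℝ) - i) c :=
    ⟨Finset.mem_univ _, fun j _ => by simp [hc]⟩
  have hρc : hardValue n h c = 0 := by simp [hardValue, hc]
  have hρM : hardValue n h M = 1 := by simp [hardValue, hM]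
  have hother : ∀ j : Fin n, j ≠ c → j ≠ M →
      hardValue n h j = 1 - h + (j : ℝ) / (n : ℝ) ^ 2 := by
    intro j hjc hjM
    rw [hardValue, if_neg fun h' => hjc (Fin.ext h'), if_neg fun h' => hjM (Fin.ext h')]
  have hOPT : h - 2 / n ≤ OPT (hardValue n h) (fun i => (n : ℝ) - i) := by
    refine le_OPT hinst hbest hcM (by linarith) (by linarith) ?_
    rw [hρc, hρM, mul_zero, zero_add, mul_one]
    exact sum_hardValue_le (by linarith) hn2
  have hub : (1 - h) * successProb (fun i => (n : ℝ) - i) φ ≤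
      2 * (1 - h) / n + h / 2 + 1 / n := by
    refine mul_successProb_le hinst hφ hcM hbest (by linarith) hn1.le h0.le hρc ?_ (by linarith) ?_
    · intro j hjc
      by_cases hjM : j = M
      · rw [hjM, hρM]
        linarith
      · rw [hother j hjc hjM]
        have : (0 : ℝ) ≤ (j : ℝ) / (n : ℝ) ^ 2 := by positivity
        linarith
    · intro j hjc hjM
      rw [hother j hjc hjM]
      linarith [div_sq_lt j]
  refine le_trans ?_ (mul_le_mul_of_nonneg_left hOPT (by linarith))
  set s := successProb (fun i : Fin n => (n : ℝ) - i) φ with hs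
  set t := 1 / (n : ℝ) with ht
  have hub' : (1 - h) * s ≤ 2 * (1 - h) * t + h / 2 + t := by
    have : 2 * (1 - h) / (n : ℝ) = 2 * (1 - h) * t := by ring
    linarith
  have hnε' : (10 + 4 * ε) * t < ε * h := by
    have : (10 + 4 * ε) / (n : ℝ) = (10 + 4 * ε) * t := by ring
    linarith
  rw [hdouble]
  -- Division by `1 - h`, using `1 / (1 - h) ≤ 1 + 2 * h ≤ 2` for `h ≤ 1 / 2`. The target then
  -- reduces to `h ^ 2 + (5 + 2 * ε) * t ≤ ε * h`, and each summand is at most `ε * h / 2` by the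
  -- choices of `h` and `N`.
  have hs' : s ≤ h / 2 + h ^ 2 + 4 * t := by
    refine le_of_mul_le_mul_left (hub'.trans ?_) (by linarith : 0 < 1 - h)
    nlinarith [mul_pos h0 h0, mul_nonneg (mul_pos h0 h0).le (by linarith : 0 ≤ 1 / 2 - h),
      mul_nonneg hn1.le (by linarith : 0 ≤ 1 / 2 - h)]
  nlinarith

end OnlinePersuasion

theorem mainTheorem8 :
    (∀ (n : ℕ), 1 ≤ n → ∀ (ρ ξ : Fin n → ℝ), OnlinePersuasion.IsInstance ρ ξ →
      OnlinePersuasion.PersuasiveWithDisclosure ρ (OnlinePersuasion.shrinkingPareto ρ ξ) ∧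
      OnlinePersuasion.OPT ρ ξ * (1 / 2 - 1 / (2 * (n : ℝ))) ≤
        OnlinePersuasion.successProb ξ (OnlinePersuasion.shrinkingPareto ρ ξ)) ∧
    (∀ ε : ℝ, 0 < ε → ∃ N : ℕ, ∀ n : ℕ, N ≤ n → ∃ ρ ξ : Fin n → ℝ,
      OnlinePersuasion.IsInstance ρ ξ ∧
      ∀ φ : OnlinePersuasion.Mechanism n, OnlinePersuasion.PersuasiveWithDisclosure ρ φ →
        OnlinePersuasion.successProb ξ φ ≤ (1 / 2 + ε) * OnlinePersuasion.OPT ρ ξ) := by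
  refine ⟨fun n hn ρ ξ h => ⟨OnlinePersuasion.shrinkingPareto_persuasive h,
    OnlinePersuasion.shrinkingPareto_successProb hn h⟩, ?_⟩
  exact OnlinePersuasion.exists_hard_instance
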